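/- Let $X$ be a compact metric space and let $r\colon X\to X$ be continuous, onto, finite-to-one ($0<\#r^{-1}(x)<\infty$ for all $x$) and not invertible. Let $\rho$ be a Borel probability measure on $X$ which gives positive measure to every non-empty open set and is strongly invariant, i.e. $\int_X f\,d\rho=\int_X\frac1{\#r^{-1}(x)}\sum_{r(y)=x}f(y)\,d\rho(x)$ for all bounded measurable $f$. Let $$X_\infty=\{(z_n)_{n\in\mathbb Z}\in X^{\mathbb Z}\mid r(z_{n+1})=z_n\text{ for all }n\in\mathbb Z\}$$ with the topology inherited from $X^{\mathbb Z}$ (a compact space), and let $\hat r$ be the homeomorphism $(z_n)_n\mapsto(z_{n-1})_n$ of $X_\infty$. Let $C=\{x_0,\dots,x_{p-1}\}$ be a cycle of length $p\ge1$: the $x_i$ are distinct and $r(x_{i+1})=x_i$, with indices modulo $p$. For $x\in X$ let $$\mathbf N_C(x)=\{\omega=(z_n)_n\in X_\infty\mid z_0=x,\ \lim_{n\to\infty}z_{pn}\in C\},$$ and for $\omega\in\mathbf N_C(x)$ let $i(\omega)$ be the index $i$ with $\lim_{n\to\infty} z_{pn}=x_i$. Let $\lambda_C$ be the Borel measure on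 $X_\infty$ given by $\lambda_C(E)=\int_X\#(E\cap\mathbf N_C(x))\,d\rho(x)$, that is, $\int f\,d\lambda_C=\int_X\sum_{\omega\in\mathbf N_C(x)}f(\omega)\,d\rho(x)$. Let $\alpha_0,\dots,\alpha_{p-1}$ be complex numbers of modulus $1$. Assume that $\mathbf N_C(x)$ is non-empty for every $x\in X$. Then the formula $$(U\xi)(\omega)=\alpha_{i(\omega)}\sqrt{\#r^{-1}(r(z_0))}\;\xi(\hat r(\omega)),\qquad \omega=(z_n)_n,\ \xi\in L^2(X_\infty,\lambda_C),$$ defines a unitary operator $U$ on $L^2(X_\infty,\lambda_C)$ which, together with the multiplication operators $M_f$, $f\in C(X_\infty)$, satisfies $UM_fU^*=M_{f\circ\hat r}$. The resulting representation $(f,k)\mapsto M_fU^k$ of the C*-crossed product $C(X_\infty)\rtimes_{\hat r}\mathbb Z$ (the C*-algebra completion, in the universal norm, of the *-algebra spanned by the symbols $(f,k)$, $f\in C(X_\infty)$, $k\in\mathbb Z$, with product $(f,k)(g,l)=(f\cdot g\circ\hat r^{k},\,k+l)$) on $L^2(X_\infty,\lambda_C)$ exists and is faithful (injective). -/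

import Mathlib

open MeasureTheory Filter Topology Set
open scoped ENNReal

universe u

namespace Solenoid

section AnalyticSets

/-- Analytic subsets of a compact metric space are measurable for every completed finite Borel
measure.  This is needed to see that the fibre sums below can be integrated. -/
theorem nullMeasurableSet_of_analyticSet {X : Type*} [MetricSpace X] [CompactSpace X]
    [MeasurableSpace X] [BorelSpace X] (μ : Measure X) [IsFiniteMeasure μ] {s : Set X}
    (hs : AnalyticSet s) : NullMeasurableSet s μ := by
  rw [AnalyticSet] at hs
  rcases hs with rfl | ⟨f, hf, rfl⟩
  · exact MeasurableSet.empty.nullMeasurableSet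
  -- for every error there is a compact subset that exhausts the set up to this error
  have key : ∀ ε : ℝ≥0∞, ε ≠ 0 → ∃ K : Set X, MeasurableSet K ∧ K ⊆ range f ∧
      μ (range f) ≤ μ K + ε := by
    intro ε hε
    obtain ⟨δ, hδ0, hδ⟩ := ENNReal.exists_pos_sum_of_countable' hε ℕ
    -- one more coordinate can be bounded at the cost of a small error
    have step : ∀ (n : ℕ) (S : Set (ℕ → ℕ)), ∃ k : ℕ,
        μ (f '' S) ≤ μ (f '' (S ∩ {σ | σ n ≤ k})) + δ n := by
      intro n S
      have hmono : Monotone (fun k : ℕ => f '' (S ∩ {σ | σ n ≤ k})) := by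
        intro a b hab
        apply image_mono
        rintro σ ⟨h1, h2⟩
        exact ⟨h1, le_trans h2 hab⟩
      have hU : (⋃ k : ℕ, f '' (S ∩ {σ | σ n ≤ k})) = f '' S := by
        rw [← image_iUnion, ← inter_iUnion]
        congr 1
        apply inter_eq_left.2
        intro σ _
        exact mem_iUnion.2 ⟨σ n, by simp⟩
      have hsup := hmono.measure_iUnion (μ := μ)
      rw [hU] at hsup
      by_contra hcon
      push Not at hcon
      have h1 : μ (f '' S) + δ n ≤ μ (f '' S) := by
        conv_lhs => rw [hsup, ENNReal.iSup_add]
        exact iSup_le fun k => (hcon k).le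
      have h2 : μ (f '' S) < μ (f '' S) + δ n :=
        ENNReal.lt_add_right (measure_ne_top μ _) (hδ0 n).ne'
      exact absurd h2 (not_lt.2 h1)
    choose k hk using step
    let S : ℕ → Set (ℕ → ℕ) := fun n => Nat.rec univ (fun n T => T ∩ {σ | σ n ≤ k n T}) n
    have hS : ∀ n, S (n + 1) = S n ∩ {σ | σ n ≤ k n (S n)} := fun n => rfl
    let m : ℕ → ℕ := fun n => k n (S n)
    have hSm : ∀ n, S n = {σ | ∀ i < n, σ i ≤ m i} := by
      intro n
      induction n with
      | zero => simp [S]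
      | succ n ih =>
        rw [hS, ih]
        ext σ
        simp only [mem_inter_iff, mem_ofPred_eq, Nat.lt_succ_iff_lt_or_eq]
        constructor
        · rintro ⟨h1, h2⟩ i (hi | rfl)
          · exact h1 i hi
          · show σ i ≤ k i (S i)
            rw [ih]; exact h2
        · intro h
          refine ⟨fun i hi => h i (Or.inl hi), ?_⟩
          have := h n (Or.inr rfl)
          change σ n ≤ k n (S n) at this
          rwa [ih] at this
    have hbound : ∀ n, μ (range f) ≤ μ (f '' S n) + ∑ i ∈ Finset.range n, δ i := by
      intro n
      induction n with
      | zero => simp [S]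
      | succ n ih =>
        calc μ (range f) ≤ μ (f '' S n) + ∑ i ∈ Finset.range n, δ i := ih
          _ ≤ (μ (f '' S (n + 1)) + δ n) + ∑ i ∈ Finset.range n, δ i := by
              gcongr
              exact hk n (S n)
          _ = _ := by rw [Finset.sum_range_succ]; ring
    let K : Set (ℕ → ℕ) := {σ | ∀ i, σ i ≤ m i}
    have hK : IsCompact K := by
      have : K = Set.pi univ (fun i => Set.Iic (m i)) := by
        ext σ; simp [K, Pi.le_def]
      rw [this]
      exact isCompact_univ_pi fun i => (Set.finite_Iic (m i)).isCompact
    have hfK : IsCompact (f '' K) := hK.image hf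
    refine ⟨f '' K, hfK.isClosed.measurableSet, image_subset_range _ _, ?_⟩
    -- every open set around the compact image already contains some `f '' S n`
    have hopen : ∀ U : Set X, f '' K ⊆ U → IsOpen U → ∃ n, f '' S n ⊆ U := by
      intro U hKU hU
      have hV : IsOpen (f ⁻¹' U) := hU.preimage hf
      by_contra hcon
      push Not at hcon
      have hex : ∀ n, ∃ σ ∈ S n, f σ ∉ U := by
        intro n
        obtain ⟨y, ⟨σ, hσ, rfl⟩, hy⟩ := not_subset.1 (hcon n)
        exact ⟨σ, hσ, hy⟩
      choose τ hτS hτU using hex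
      let τ' : ℕ → ℕ → ℕ := fun n i => if i < n then τ n i else 0
      have hτ'K : ∀ n, τ' n ∈ K := by
        intro n i
        by_cases hi : i < n
        · have := hτS n
          rw [hSm] at this
          simpa [τ', hi] using this i hi
        · simp [τ', hi]
      obtain ⟨a, haK, φ, hφ, hlim⟩ := hK.tendsto_subseq hτ'K
      have hlim' : Tendsto (fun j => τ (φ j)) atTop (𝓝 a) := by
        rw [tendsto_pi_nhds] at hlim ⊢
        intro i
        refine (hlim i).congr' ?_
        filter_upwards [eventually_gt_atTop i] with j hj
        have : i < φ j := lt_of_lt_of_le hj (hφ.id_le j)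
        simp [τ', this]
      have haU : a ∈ f ⁻¹' U := hKU ⟨a, haK, rfl⟩
      obtain ⟨j, hj⟩ := (hlim'.eventually (hV.mem_nhds haU)).exists
      exact hτU _ hj
    have hle : ∀ U : Set X, f '' K ⊆ U → IsOpen U → μ (range f) ≤ μ U + ε := by
      intro U hKU hU
      obtain ⟨n, hn⟩ := hopen U hKU hU
      calc μ (range f) ≤ μ (f '' S n) + ∑ i ∈ Finset.range n, δ i := hbound n
        _ ≤ μ U + ε := by
            gcongr
            exact (ENNReal.sum_le_tsum _).trans hδ.le
    refine ENNReal.le_of_forall_pos_le_add fun η hη _ => ?_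
    obtain ⟨U, hKU, hU, hUη⟩ := (f '' K).exists_isOpen_le_add μ (ε := (η : ℝ≥0∞))
      (by exact_mod_cast hη.ne')
    calc μ (range f) ≤ μ U + ε := hle U hKU hU
      _ ≤ (μ (f '' K) + η) + ε := by gcongr
      _ = _ := by ring
  have hne : ∀ n : ℕ, ((n : ℝ≥0∞) + 1)⁻¹ ≠ 0 := fun n => by
    simp
  choose K hKm hKs hKμ using fun n : ℕ => key _ (hne n)
  have hKU : MeasurableSet (⋃ n, K n) := MeasurableSet.iUnion hKm
  have hsub : (⋃ n, K n) ⊆ range f := iUnion_subset hKs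
  have hle : μ (range f) ≤ μ (⋃ n, K n) := by
    have h0 : Tendsto (fun n : ℕ => μ (⋃ n, K n) + ((n : ℝ≥0∞) + 1)⁻¹) atTop
        (𝓝 (μ (⋃ n, K n) + 0)) := by
      refine Tendsto.const_add _ ?_
      have := (tendsto_add_atTop_iff_nat 1).2 ENNReal.tendsto_inv_nat_nhds_zero
      simpa using this
    rw [add_zero] at h0
    refine ge_of_tendsto' h0 fun n => (hKμ n).trans ?_
    gcongr
    exact subset_iUnion K n
  have hae : (⋃ n, K n : Set X) =ᵐ[μ] range f :=
    ae_eq_of_subset_of_measure_ge hsub hle hKU.nullMeasurableSet (measure_ne_top μ _)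
  exact hKU.nullMeasurableSet.congr hae

/-- The number of points of a Borel set `E` in the fibre over `x` of a continuous map is a
measurable function of `x`, up to a null set. -/
theorem aemeasurable_fiber_encard {X Y : Type*} [MetricSpace X] [CompactSpace X]
    [MeasurableSpace X] [BorelSpace X] [TopologicalSpace Y] [PolishSpace Y]
    [MeasurableSpace Y] [BorelSpace Y] (μ : Measure X) [IsFiniteMeasure μ] {g : Y → X}
    (hg : Continuous g) {E : Set Y} (hE : MeasurableSet E) :
    AEMeasurable (fun x => ((E ∩ g ⁻¹' {x}).encard : ℝ≥0∞)) μ := by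
  obtain ⟨b, hbc, -, hb⟩ := TopologicalSpace.exists_countable_basis Y
  have : Countable b := hbc.to_subtype
  -- finite disjoint families of basic sets
  let F : Type _ := {I : Finset b // (I : Set b).PairwiseDisjoint (fun s => (s : Set Y))}
  let G : b → Set X := fun s => g '' (E ∩ s)
  have hG : ∀ s, NullMeasurableSet (G s) μ := fun s =>
    nullMeasurableSet_of_analyticSet μ
      (((hE.inter (hb.isOpen s.2).measurableSet).analyticSet).image_of_continuous hg)
  have hform : (fun x => ((E ∩ g ⁻¹' {x}).encard : ℝ≥0∞)) =
      fun x => ⨆ I : F, ∑ s ∈ I.1, (G s).indicator (fun _ => (1 : ℝ≥0∞)) x := by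
    classical
    funext x
    apply le_antisymm
    · -- separate the points of a finite subset of the fibre
      have hfin : ∀ t : Finset Y, (t : Set Y) ⊆ E ∩ g ⁻¹' {x} →
          (t.card : ℝ≥0∞) ≤ ⨆ I : F, ∑ s ∈ I.1, (G s).indicator (fun _ => (1 : ℝ≥0∞)) x := by
        intro t ht
        obtain ⟨U, hU, hUd⟩ := (t.finite_toSet).t2_separation
        have hex : ∀ y : Y, ∃ s : b, y ∈ (s : Set Y) ∧ (s : Set Y) ⊆ U y := by
          intro y
          obtain ⟨s, hs, hys, hsU⟩ := hb.exists_subset_of_mem_open (hU y).1 (hU y).2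
          exact ⟨⟨s, hs⟩, hys, hsU⟩
        choose S hSy hSU using hex
        have hinj : Set.InjOn S (t : Set Y) := by
          intro y hy z hz hyz
          by_contra hne
          have hd := hUd hy hz hne
          exact Set.disjoint_left.1 hd (hSU y (hSy y)) (hSU z (hyz ▸ hSy y))
        have hd : ((t.image S : Finset b) : Set b).PairwiseDisjoint (fun s => (s : Set Y)) := by
          intro s hs s' hs' hne
          simp only [Finset.coe_image, Set.mem_image] at hs hs'
          obtain ⟨y, hy, rfl⟩ := hs
          obtain ⟨z, hz, rfl⟩ := hs'
          have hyz : y ≠ z := fun h => hne (h ▸ rfl)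
          exact (hUd hy hz hyz).mono (hSU y) (hSU z)
        refine le_trans ?_ (le_iSup _ (⟨t.image S, hd⟩ : F))
        simp only
        rw [Finset.sum_image hinj]
        have : ∀ y ∈ t, (G (S y)).indicator (fun _ => (1 : ℝ≥0∞)) x = 1 := by
          intro y hy
          have hy' := ht hy
          have hx : x ∈ G (S y) := ⟨y, ⟨hy'.1, hSy y⟩, hy'.2⟩
          simp [hx]
        rw [Finset.sum_congr rfl this]
        simp
      by_cases hfs : (E ∩ g ⁻¹' {x}).Finite
      · have h := hfin hfs.toFinset (by simp)
        rw [hfs.encard_eq_coe_toFinset_card]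
        exact_mod_cast h
      · have hinf : (E ∩ g ⁻¹' {x}).Infinite := hfs
        have : ∀ n : ℕ, (n : ℝ≥0∞) ≤
            ⨆ I : F, ∑ s ∈ I.1, (G s).indicator (fun _ => (1 : ℝ≥0∞)) x := by
          intro n
          obtain ⟨t, ht, htn⟩ := hinf.exists_subset_card_eq n
          rw [← htn]
          exact hfin t ht
        have htop := ENNReal.eq_top_of_forall_nnreal_le (fun q => by
          obtain ⟨n, hn⟩ := exists_nat_ge q
          exact le_trans (by exact_mod_cast hn) (this n))
        rw [htop]
        exact le_top
    · refine iSup_le fun I => ?_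
      have hsum : ∑ s ∈ I.1, (G s).indicator (fun _ => (1 : ℝ≥0∞)) x =
          ((I.1.filter (fun s => x ∈ G s)).card : ℝ≥0∞) := by
        rw [Finset.card_filter]
        push_cast
        refine Finset.sum_congr rfl fun s _ => ?_
        simp [indicator_apply]
      rw [hsum]
      rcases isEmpty_or_nonempty Y with hY | hY
      · have : (I.1.filter (fun s => x ∈ G s)) = ∅ := by
          refine Finset.filter_eq_empty_iff.2 fun s _ hs => ?_
          obtain ⟨y, -⟩ := hs
          exact hY.elim y
        rw [this]
        simp
      have hch : ∀ s : b, x ∈ G s → ∃ y : Y, y ∈ E ∩ (s : Set Y) ∧ g y = x := fun s h => h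
      choose! y hy using hch
      have hle : ((I.1.filter (fun s => x ∈ G s) : Finset b) : Set b).encard ≤
          (E ∩ g ⁻¹' {x}).encard := by
        refine Set.encard_le_encard_of_injOn (f := y) ?_ ?_
        · intro s hs
          have hs' := (Finset.mem_filter.1 hs).2
          exact ⟨(hy s hs').1.1, (hy s hs').2⟩
        · intro s hs s' hs' hss
          by_contra hne
          have h1 := Finset.mem_filter.1 hs
          have h2 := Finset.mem_filter.1 hs'
          have hd := I.2 h1.1 h2.1 hne
          exact Set.disjoint_left.1 hd (hy s h1.2).1.2 (hss ▸ (hy s' h2.2).1.2)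
      rw [Set.encard_coe_eq_coe_finsetCard] at hle
      exact_mod_cast hle
  rw [hform]
  refine AEMeasurable.iSup fun I => ?_
  refine Finset.aemeasurable_fun_sum _ fun s _ => ?_
  exact aemeasurable_const.indicator₀ (hG s)

end AnalyticSets

section PathSpace

/-- The space of paths of `r`, as a space of two-sided sequences `(z_n)` with
`r (z_{n+1}) = z_n`; it carries the topology (and Borel structure) inherited from the
product.  A path `(z_1, z_2, …)` starting at `x` is the sequence with `z_0 = x`. -/
abbrev PathSpace {X : Type u} (r : X → X) : Type u :=
  {z : ℤ → X // ∀ n : ℤ, r (z (n + 1)) = z n}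

theorem isClosed_pathSpace {X : Type u} [MetricSpace X] (r : C(X, X)) :
    IsClosed {z : ℤ → X | ∀ n : ℤ, r (z (n + 1)) = z n} := by
  simp only [ofPred_forall]
  exact isClosed_iInter fun n => isClosed_eq
    (r.continuous.comp (continuous_apply (n + 1))) (continuous_apply n)

instance compactSpace_pathSpace {X : Type u} [MetricSpace X] [CompactSpace X] (r : C(X, X)) :
    CompactSpace (PathSpace r) :=
  isCompact_iff_compactSpace.1 (isClosed_pathSpace r).isCompact

/-- The automorphism `(z_n) ↦ (z_{n-1})` of the space of paths. -/
def shift {X : Type u} [TopologicalSpace X] (r : X → X) : PathSpace r ≃ₜ PathSpace r where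
  toFun z := ⟨fun n => z.1 (n - 1), fun n => by
    have h := z.2 (n - 1)
    rw [sub_add_cancel] at h
    simpa using h⟩
  invFun z := ⟨fun n => z.1 (n + 1), fun n => z.2 (n + 1)⟩
  left_inv z := by ext n; simp
  right_inv z := by ext n; simp
  continuous_toFun := Continuous.subtype_mk (f := fun (z : PathSpace r) (n : ℤ) => z.1 (n - 1))
    (continuous_pi fun n => (continuous_apply (n - 1)).comp continuous_subtype_val) _
  continuous_invFun := Continuous.subtype_mk (f := fun (z : PathSpace r) (n : ℤ) => z.1 (n + 1))
    (continuous_pi fun n => (continuous_apply (n + 1)).comp continuous_subtype_val) _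

/-- The set of paths that start at `x`. -/
def pathsFrom {X : Type u} (r : X → X) (x : X) : Set (PathSpace r) := {z | z.1 0 = x}

/-- `c 0, …, c (p-1)` is a cycle of length `p`: the points are distinct and
`r (c (i+1)) = c i`, where the indices are taken modulo `p`. -/
def IsCycle {X : Type u} (r : X → X) {p : ℕ} [NeZero p] (c : Fin p → X) : Prop :=
  Function.Injective c ∧ ∀ i, r (c (i + 1)) = c i

/-- The set of all paths with `lim z_{pn} = c i`. -/
def convergesTo {X : Type u} [TopologicalSpace X] (r : X → X) {p : ℕ} (c : Fin p → X)
    (i : Fin p) : Set (PathSpace r) :=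
  {z | Tendsto (fun n : ℕ => z.1 (p * n : ℕ)) atTop (𝓝 (c i))}

/-- The set of the paths that start at `x` and with `lim z_{pn}` in the cycle. -/
def cyclePaths {X : Type u} [TopologicalSpace X] (r : X → X) {p : ℕ} (c : Fin p → X) (x : X) :
    Set (PathSpace r) :=
  {z | z ∈ pathsFrom r x ∧ ∃ i, z ∈ convergesTo r c i}

open Classical in
/-- The index `i(ω)` with `lim z_{pn} = c i` for a path `ω = (z_n)` which is attracted by the
cycle; for the other paths (a null set for the measure below) the value is irrelevant. -/
noncomputable def limitIndex {X : Type u} [TopologicalSpace X] (r : X → X) {p : ℕ} [NeZero p]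
    (c : Fin p → X) (z : PathSpace r) : Fin p :=
  if h : ∃ i, z ∈ convergesTo r c i then h.choose else 0

/-- Strong invariance: `∫ f dρ = ∫ (1 / #r⁻¹(x)) ∑_{r y = x} f(y) dρ(x)` for bounded
measurable functions `f`. -/
def IsStronglyInvariant {X : Type u} [MeasurableSpace X] (r : X → X) (ρ : Measure X) : Prop :=
  ∀ f : X → ℂ, Measurable f → (∃ K : ℝ, ∀ x, ‖f x‖ ≤ K) →
    ∫ x, f x ∂ρ = ∫ x, (((r ⁻¹' {x}).ncard : ℂ))⁻¹ * ∑ᶠ y ∈ r ⁻¹' {x}, f y ∂ρ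

theorem tsum_cyclePaths {X : Type u} [MetricSpace X] (r : C(X, X)) {p : ℕ} (c : Fin p → X) (E : Set (PathSpace r)) (x : X) :
    ∑' ω : cyclePaths r c x, E.indicator (1 : PathSpace r → ℝ≥0∞) ω =
      (((E ∩ {z | ∃ i, z ∈ convergesTo r c i}) ∩
        (fun z : PathSpace r => z.1 0) ⁻¹' {x}).encard : ℝ≥0∞) := by
  have h : (E ∩ {z | ∃ i, z ∈ convergesTo r c i}) ∩ (fun z : PathSpace r => z.1 0) ⁻¹' {x} =
      cyclePaths r c x ∩ E := by
    ext z
    simp only [cyclePaths, pathsFrom, mem_inter_iff, mem_ofPred_eq, mem_preimage,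
      mem_singleton_iff]
    tauto
  rw [h, ← ENNReal.tsum_set_one, tsum_subtype,
    tsum_subtype (cyclePaths r c x ∩ E) (fun _ => (1 : ℝ≥0∞))]
  congr 1
  ext z
  by_cases h1 : z ∈ cyclePaths r c x <;> by_cases h2 : z ∈ E <;> simp [h1, h2]

variable {X : Type u} [MetricSpace X] [CompactSpace X] [MeasurableSpace X] [BorelSpace X]

theorem aemeasurable_tsum_cyclePaths (r : C(X, X)) (ρ : Measure X) [IsFiniteMeasure ρ] {p : ℕ}
    (c : Fin p → X) {E : Set (PathSpace r)} (hE : MeasurableSet E) :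
    AEMeasurable
      (fun x => ∑' ω : cyclePaths r c x, E.indicator (1 : PathSpace r → ℝ≥0∞) ω) ρ := by
  simp_rw [tsum_cyclePaths]
  have hpol : PolishSpace (PathSpace r) := (isClosed_pathSpace r).polishSpace
  refine aemeasurable_fiber_encard ρ (g := fun z : PathSpace r => z.1 0)
    ((continuous_apply 0).comp continuous_subtype_val) (hE.inter ?_)
  rw [ofPred_exists]
  refine MeasurableSet.iUnion fun i => ?_
  exact measurableSet_tendsto (𝓝 (c i))
    (f := fun (n : ℕ) (z : PathSpace r) => z.1 ((p * n : ℕ) : ℤ)) 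
    (fun n => (measurable_pi_apply _).comp measurable_subtype_coe)

/-- The measure `λ_C` on the space of paths:
`λ_C(E) = ∫ ∑_{ω ∈ N_C(x)} 1_E(ω) dρ(x)` for every Borel set `E`. -/
noncomputable def pathMeasure (r : C(X, X)) (ρ : Measure X) [IsFiniteMeasure ρ] {p : ℕ}
    (c : Fin p → X) : Measure (PathSpace r) :=
  Measure.ofMeasurable
    (fun E _ => ∫⁻ x, ∑' ω : cyclePaths r c x, E.indicator (1 : PathSpace r → ℝ≥0∞) ω ∂ρ)
    (by simp)
    (by
      intro E hE hd
      rw [← lintegral_tsum fun i => aemeasurable_tsum_cyclePaths r ρ c (hE i)]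
      congr 1
      funext x
      rw [ENNReal.tsum_comm]
      refine tsum_congr fun ω => ?_
      by_cases h : ∃ i, (ω : PathSpace r) ∈ E i
      · obtain ⟨i, hi⟩ := h
        rw [tsum_eq_single i, indicator_of_mem (mem_iUnion.2 ⟨i, hi⟩), indicator_of_mem hi]
        intro j hj
        exact indicator_of_notMem (fun h' => Set.disjoint_left.1 (hd hj) h' hi) _
      · have h1 : (ω : PathSpace r) ∉ ⋃ i, E i := by simpa using h
        push Not at h
        simp [h1, h])

end PathSpace

section Operators

/-- The bounded operators on `L²(μ)`. -/
abbrev L2Operators {Y : Type u} [MeasurableSpace Y] (μ : Measure Y) : Type u :=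
  Lp ℂ 2 μ →L[ℂ] Lp ℂ 2 μ

variable {Y : Type u} [TopologicalSpace Y] [CompactSpace Y] [MeasurableSpace Y] [BorelSpace Y]

/-- The operator `M_f` of multiplication by a continuous function `f` on `L²(μ)`. -/
noncomputable def mulOp (μ : Measure Y) (f : C(Y, ℂ)) : L2Operators μ :=
  (ContinuousLinearMap.mul ℂ ℂ).holderL μ ∞ 2 2
    (MemLp.toLp f (memLp_top_of_bound f.continuous.aestronglyMeasurable ‖f‖
      (Eventually.of_forall f.norm_coe_le_norm)))

theorem coeFn_mulOp (μ : Measure Y) (f : C(Y, ℂ)) (ξ : Lp ℂ 2 μ) :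
    mulOp μ f ξ =ᵐ[μ] fun y => f y * ξ y := by
  have hf := MemLp.coeFn_toLp (memLp_top_of_bound (μ := μ) f.continuous.aestronglyMeasurable ‖f‖
      (Eventually.of_forall f.norm_coe_le_norm))
  have h := (ContinuousLinearMap.mul ℂ ℂ).coeFn_holder (r := 2) (MemLp.toLp f
    (memLp_top_of_bound (μ := μ) f.continuous.aestronglyMeasurable ‖f‖
      (Eventually.of_forall f.norm_coe_le_norm))) ξ
  filter_upwards [hf, h] with y h1 h2
  simp only [mulOp, ContinuousLinearMap.holderL_apply_apply]
  rw [h2, h1]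
  rfl

end Operators

section CrossedProduct

variable {Y : Type u} [TopologicalSpace Y] [CompactSpace Y]

/-- A covariant representation of the dynamical system `(C(Y), σ)` on a (nonzero) Hilbert space:
a unital representation `π` of `C(Y)` by bounded operators and a unitary operator `V` such that
`V π(f) V* = π(f ∘ σ)`. -/
structure CovariantRep (σ : Y ≃ₜ Y) where
  H : Type u
  [normed : NormedAddCommGroup H]
  [inner : InnerProductSpace ℂ H]
  [complete : CompleteSpace H]
  [nontrivial : Nontrivial H]
  π : C(Y, ℂ) →⋆ₐ[ℂ] (H →L[ℂ] H)
  V : unitary (H →L[ℂ] H)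
  covariance : ∀ f : C(Y, ℂ), (V : H →L[ℂ] H) * π f * star (V : H →L[ℂ] H) =
    π (f.comp (σ : C(Y, Y)))

attribute [instance] CovariantRep.normed CovariantRep.inner CovariantRep.complete
  CovariantRep.nontrivial

/-- The C*-algebra of bounded families of operators, one for each covariant representation. -/
abbrev BoundedFamilies (σ : Y ≃ₜ Y) : Type (u + 1) :=
  lp (fun R : CovariantRep σ => R.H →L[ℂ] R.H) ∞

/-- The family `(π(f) V^k)`, over all covariant representations `(π, V)`: the image of the formal
symbol `(f, k)` in the universal representation. -/
noncomputable def family (σ : Y ≃ₜ Y) (f : C(Y, ℂ)) (k : ℤ) : BoundedFamilies σ :=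
  ⟨fun R => R.π f * ((R.V ^ k : unitary (R.H →L[ℂ] R.H)) : R.H →L[ℂ] R.H), by
    refine memℓp_infty ⟨‖f‖, ?_⟩
    rintro _ ⟨R, rfl⟩
    calc _ ≤ ‖R.π f‖ * ‖((R.V ^ k : unitary (R.H →L[ℂ] R.H)) : R.H →L[ℂ] R.H)‖ :=
          norm_mul_le _ _
      _ ≤ ‖f‖ * 1 := by
          gcongr
          · exact NonUnitalStarAlgHom.norm_apply_le R.π f
          · exact (CStarRing.norm_coe_unitary _).le
      _ = ‖f‖ := mul_one _⟩

/-- The C*-crossed product `C(Y) ⋊_σ ℤ`: the completion of the *-algebra spanned by the formal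
symbols `(f, k)` in the largest norm that comes from a covariant representation, realized as the
closed *-subalgebra generated by the symbols in the direct sum of all covariant representations.
(Every covariant representation is a direct sum of cyclic ones, and these have a copy in the
universe of `Y`, so that this universe suffices.) -/
noncomputable def crossedProduct (σ : Y ≃ₜ Y) : StarSubalgebra ℂ (BoundedFamilies σ) :=
  (StarAlgebra.adjoin ℂ {a | ∃ (f : C(Y, ℂ)) (k : ℤ), a = family σ f k}).topologicalClosure

/-- The element `(f, k)` of the crossed product. -/
noncomputable def symbol (σ : Y ≃ₜ Y) (f : C(Y, ℂ)) (k : ℤ) : crossedProduct σ :=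
  ⟨family σ f k, StarSubalgebra.le_topologicalClosure _
    (StarAlgebra.subset_adjoin ℂ _ ⟨f, k, rfl⟩)⟩

end CrossedProduct

end Solenoid

/-! `U` is a weighted composition operator with `|weight|² = #r⁻¹(r z₀)`, so it is isometric as soon
as the integral of `#r⁻¹(r z₀)` over `r̂⁻¹E` is `λ_C(E)`. By definition of `λ_C` the former is the
integral over `X` of `#r⁻¹(r x) · #(r̂⁻¹E ∩ N_C(x))`. Strong invariance replaces the integrand by
its mean over `r⁻¹{x}`. The weight is constant there and cancels the normalization, and `r̂` maps
the attracted paths starting in `r⁻¹{x}` bijectively onto those starting at `x`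
(`lintegral_shift_preimage`). The weight has no zeros, so `U` is onto
(`exists_unitary_weightedComp`). Covariance is then a pointwise identity.

The representation of the crossed product exists because `(M, U)` is one of the summands of the
universal representation. Its faithfulness has three ingredients.

Faithfulness on `C(X_∞)`: an open set of paths contains a cylinder `z_n ∈ W`, and a power of `r̂`
moves it to `z_0 ∈ W`. Nothing bounds the number of attracted paths in a fibre, so a set of finite
positive measure has to be found there: a Borel set meeting each fibre at most once, with image of
positive measure (`exists_measurableSet_injOn_measure_image_pos`).

Topological freeness: suppose all paths in some open set have period `d`. After a translation these
are all paths starting in an open `W`. An attracted periodic path starts in the cycle, so `W ⊆ C`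
and some point of `C` is isolated. Periodicity forces it to have a single preimage, and both
properties spread over `C`. Every attracted path then eventually meets `C` exactly, so `X = C` and
`r` is injective (`injective_of_periodic`).

Topological freeness and amenability of `ℤ` give faithfulness: in any covariant representation `‖∑
π(f_k) V^k‖` is bounded by the finite matrices `(f_{j-n}(σⁿ y))` over all points `y`
(`norm_eval_apply_le`). By density aperiodic `y` suffice, and at such `y` a vector localized near
`y` shows that a representation faithful on functions dominates the matrix
(`sum_norm_sq_le_of_aperiodic`). -/

namespace Solenoid

/-! ### Borel sections over sets of positive measure -/

/-- A continuous image of the Baire space with positive outer measure contains the image of a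
compact set with positive measure. -/
theorem exists_isCompact_measure_image_pos {X : Type*} [TopologicalSpace X] [MeasurableSpace X]
    (μ : Measure X) [μ.OuterRegular] {h : (ℕ → ℕ) → X} (hh : Continuous h)
    (hpos : 0 < μ (range h)) : ∃ K : Set (ℕ → ℕ), IsCompact K ∧ 0 < μ (h '' K) := by
  -- The outer measure is continuous along increasing unions, so bounding one more coordinate can
  -- always be done while staying strictly above the fixed level `a`.
  obtain ⟨a, ha0, ha⟩ := exists_between hpos
  have step : ∀ (n : ℕ) (S : Set (ℕ → ℕ)), ∃ k : ℕ, a < μ (h '' S) →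
      a < μ (h '' (S ∩ {σ | σ n ≤ k})) := by
    intro n S
    by_cases hS : a < μ (h '' S)
    · have hmono : Monotone (fun k : ℕ => h '' (S ∩ {σ | σ n ≤ k})) := fun i j hij =>
        image_mono fun σ hσ => ⟨hσ.1, le_trans hσ.2 hij⟩
      have hU : (⋃ k : ℕ, h '' (S ∩ {σ | σ n ≤ k})) = h '' S := by
        rw [← image_iUnion, ← inter_iUnion]
        congr 1
        exact inter_eq_left.2 fun σ _ => mem_iUnion.2 ⟨σ n, by simp⟩
      rw [← hU, hmono.measure_iUnion] at hS
      obtain ⟨k, hk⟩ := lt_iSup_iff.1 hS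
      exact ⟨k, fun _ => hk⟩
    · exact ⟨0, fun h' => absurd h' hS⟩
  choose k hk using step
  let S : ℕ → Set (ℕ → ℕ) := fun n => Nat.rec univ (fun n T => T ∩ {σ | σ n ≤ k n T}) n
  have hS : ∀ n, S (n + 1) = S n ∩ {σ | σ n ≤ k n (S n)} := fun n => rfl
  let m : ℕ → ℕ := fun n => k n (S n)
  have hSm : ∀ n σ, σ ∈ S n ↔ ∀ i < n, σ i ≤ m i := by
    intro n
    induction n with
    | zero => simp [S]
    | succ n ih =>
      intro σ
      rw [hS, mem_inter_iff, ih σ]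
      constructor
      · rintro ⟨h1, h2⟩ i hi
        rcases Nat.lt_succ_iff_lt_or_eq.1 hi with hi | rfl
        · exact h1 i hi
        · exact h2
      · exact fun h' => ⟨fun i hi => h' i (hi.trans n.lt_succ_self), h' n n.lt_succ_self⟩
  have hbound : ∀ n, a < μ (h '' S n) := by
    intro n
    induction n with
    | zero => simpa [S] using ha
    | succ n ih => exact hk n (S n) ih
  let K : Set (ℕ → ℕ) := {σ | ∀ i, σ i ≤ m i}
  have hK : IsCompact K := by
    have : K = Set.pi univ (fun i => Set.Iic (m i)) := by
      ext σ; simp [K, Pi.le_def]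
    rw [this]
    exact isCompact_univ_pi fun i => (Set.finite_Iic (m i)).isCompact
  refine ⟨K, hK, lt_of_lt_of_le ha0 ?_⟩
  by_contra hcon
  obtain ⟨U, hKU, hU, hUa⟩ := (h '' K).exists_isOpen_lt_of_lt a (not_le.1 hcon)
  have hV : IsOpen (h ⁻¹' U) := hU.preimage hh
  have hex : ∀ n, ∃ σ ∈ S n, h σ ∉ U := by
    intro n
    by_contra hn
    push Not at hn
    exact absurd ((hbound n).trans_le (measure_mono (image_subset_iff.2 hn))) hUa.not_gt
  choose τ hτS hτU using hex
  -- Resetting the unconstrained tail to `0` puts the points into `K`. Each coordinate is eventually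
  -- untouched, so a limit of a subsequence of `τ'` is also one of `τ`.
  let τ' : ℕ → ℕ → ℕ := fun n i => if i < n then τ n i else 0
  have hτ'K : ∀ n, τ' n ∈ K := by
    intro n i
    by_cases hi : i < n
    · simpa [τ', hi] using (hSm n _).1 (hτS n) i hi
    · simp [τ', hi]
  obtain ⟨b, hbK, φ, hφ, hlim⟩ := hK.tendsto_subseq hτ'K
  have hlim' : Tendsto (fun j => τ (φ j)) atTop (𝓝 b) := by
    rw [tendsto_pi_nhds] at hlim ⊢
    intro i
    refine (hlim i).congr' ?_
    filter_upwards [eventually_gt_atTop i] with j hj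
    have : i < φ j := lt_of_lt_of_le hj (hφ.id_le j)
    simp [τ', this]
  have hbU : b ∈ h ⁻¹' U := hKU ⟨b, hbK, rfl⟩
  obtain ⟨j, hj⟩ := (hlim'.eventually (hV.mem_nhds hbU)).exists
  exact hτU _ hj

/-- A compact set in the Baire space has a point whose coordinates are minimal for the
lexicographic order. -/
theorem exists_lex_min {K : Set (ℕ → ℕ)} (hK : IsCompact K) (hne : K.Nonempty) :
    ∃ t ∈ K, ∀ t' ∈ K, ∀ n, (∀ i < n, t' i = t i) → t n ≤ t' n := by
  -- `T n` keeps the points that minimize the first `n` coordinates one after the other; these are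
  -- nested non-empty compact sets.
  let T : ℕ → Set (ℕ → ℕ) := fun n =>
    Nat.rec K (fun n S => S ∩ {σ | σ n = sInf ((fun τ : ℕ → ℕ => τ n) '' S)}) n
  have hT : ∀ n, T (n + 1) = T n ∩ {σ | σ n = sInf ((fun τ : ℕ → ℕ => τ n) '' T n)} :=
    fun n => rfl
  have hTne : ∀ n, (T n).Nonempty := by
    intro n
    induction n with
    | zero => exact hne
    | succ n ih =>
      obtain ⟨σ, hσ, hσ'⟩ := Nat.sInf_mem (ih.image (fun τ : ℕ → ℕ => τ n))
      exact ⟨σ, hσ, hσ'⟩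
  have hTcl : ∀ n, IsClosed (T n) := by
    intro n
    induction n with
    | zero => exact hK.isClosed
    | succ n ih => exact ih.inter (isClosed_eq (continuous_apply n) continuous_const)
  obtain ⟨t, ht⟩ := IsCompact.nonempty_iInter_of_sequence_nonempty_isCompact_isClosed T
    (fun n => (hT n).trans_subset inter_subset_left) hTne hK hTcl
  rw [mem_iInter] at ht
  refine ⟨t, ht 0, fun t' ht' n hn => ?_⟩
  have hmem : ∀ m ≤ n, t' ∈ T m := by
    intro m
    induction m with
    | zero => exact fun _ => ht'
    | succ m ih =>
      intro hm
      refine ⟨ih (by omega), ?_⟩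
      have h1 : t m = _ := (ht (m + 1)).2
      show t' m = _
      rw [hn m (by omega), h1]
  have h1 : t n = _ := (ht (n + 1)).2
  rw [h1]
  exact Nat.sInf_le ⟨t', hmem n le_rfl, rfl⟩

/-- A continuous map on a compact subset of the Baire space has a Borel section. -/
theorem exists_measurableSet_injOn_image_eq {X : Type*} [TopologicalSpace X] [T2Space X]
    {h : (ℕ → ℕ) → X} (hh : Continuous h) {K : Set (ℕ → ℕ)} (hK : IsCompact K) :
    ∃ M ⊆ K, MeasurableSet M ∧ InjOn h M ∧ h '' M = h '' K := by
  -- In a pair in `P n` the first entry beats the second, in the same fibre, at coordinate `n`. `P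
  -- n` is compact, so removing the projections leaves a Borel set: the lexicographic minima of the
  -- fibres.
  let P : ℕ → Set ((ℕ → ℕ) × (ℕ → ℕ)) := fun n =>
    (K ×ˢ K) ∩ ({q | h q.1 = h q.2} ∩ ((⋂ i, ⋂ (_ : i < n), {q | q.1 i = q.2 i}) ∩
      {q | q.1 n + 1 ≤ q.2 n}))
  have hP : ∀ n, IsCompact (P n) := by
    intro n
    have e : ∀ i, Continuous fun q : (ℕ → ℕ) × (ℕ → ℕ) => q.1 i := fun i =>
      (continuous_apply i).comp continuous_fst
    have e' : ∀ i, Continuous fun q : (ℕ → ℕ) × (ℕ → ℕ) => q.2 i := fun i =>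
      (continuous_apply i).comp continuous_snd
    exact (hK.prod hK).inter_right
      ((isClosed_eq (hh.comp continuous_fst) (hh.comp continuous_snd)).inter
        ((isClosed_iInter fun i => isClosed_iInter fun _ => isClosed_eq (e i) (e' i)).inter
          (isClosed_le ((e n).add continuous_const) (e' n))))
  let M := K \ ⋃ n, Prod.snd '' P n
  have hM : ∀ t, t ∈ M ↔ t ∈ K ∧ ∀ t' ∈ K, h t' = h t → ∀ n, (∀ i < n, t' i = t i) →
      t n ≤ t' n := by
    intro t
    simp only [M, P, Set.mem_sdiff, mem_iUnion, mem_image, mem_inter_iff, mem_prod, Prod.exists,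
      mem_iInter, mem_ofPred_eq, exists_eq_right, not_exists, not_and, Nat.not_le,
      Nat.lt_add_one_iff]
    constructor
    · exact fun H => ⟨H.1, fun t' ht' e n hn => H.2 n t' ⟨ht', H.1⟩ e hn⟩
    · exact fun H => ⟨H.1, fun n t' ht' e hn => H.2 t' ht'.1 e n hn⟩
  refine ⟨M, sdiff_subset, ?_, ?_, ?_⟩
  · exact hK.isClosed.measurableSet.diff
      (MeasurableSet.iUnion fun n => ((hP n).image continuous_snd).isClosed.measurableSet)
  · intro s hs t ht hst
    rw [hM] at hs ht
    funext n
    induction n using Nat.strong_induction_on with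
    | _ n ih =>
      exact le_antisymm (hs.2 t ht.1 hst.symm n fun i hi => (ih i hi).symm)
        (ht.2 s hs.1 hst n ih)
  · refine (image_mono sdiff_subset).antisymm ?_
    rintro _ ⟨s, hs, rfl⟩
    obtain ⟨t, ht, hmin⟩ := exists_lex_min
      (hK.inter_right (isClosed_eq hh (continuous_const (y := h s)))) ⟨s, hs, rfl⟩
    refine ⟨t, (hM t).2 ⟨ht.1, fun t' ht' e n hn => hmin t' ⟨ht', e.trans ht.2⟩ n hn⟩, ht.2⟩

/-- A Borel set whose image has positive measure contains a Borel section over a set of positive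
measure. -/
theorem exists_measurableSet_injOn_measure_image_pos {X Y : Type*} [TopologicalSpace X]
    [T2Space X] [MeasurableSpace X] (μ : Measure X) [μ.OuterRegular] [TopologicalSpace Y]
    [PolishSpace Y] [MeasurableSpace Y] [BorelSpace Y] {g : Y → X} (hg : Continuous g)
    {B : Set Y} (hB : MeasurableSet B) (hpos : 0 < μ (g '' B)) :
    ∃ E ⊆ B, MeasurableSet E ∧ InjOn g E ∧ 0 < μ (g '' E) := by
  have hBa := hB.analyticSet
  rw [AnalyticSet] at hBa
  rcases hBa with rfl | ⟨F, hF, rfl⟩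
  · simp at hpos
  rw [← range_comp] at hpos
  obtain ⟨K, hK, hKpos⟩ := exists_isCompact_measure_image_pos μ (hg.comp hF) hpos
  obtain ⟨M, -, hMm, hMi, hMK⟩ := exists_measurableSet_injOn_image_eq (hg.comp hF) hK
  refine ⟨F '' M, image_subset_range _ _, ?_, ?_, ?_⟩
  -- Lusin–Souslin: `g ∘ F` is injective on `M`, hence so is `F`.
  · exact hMm.image_of_continuousOn_injOn hF.continuousOn
      fun s hs t ht e => hMi hs ht (congrArg g e)
  · rintro _ ⟨s, hs, rfl⟩ _ ⟨t, ht, rfl⟩ e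
    rw [hMi hs ht e]
  · rwa [← image_comp, hMK]

end Solenoid

namespace Solenoid

/-! ### Integration along the fibres of a continuous map -/

section FiberIntegral

theorem tsum_indicator_const_eq_mul_encard {Y : Type*} (s t : Set Y) (a : ℝ≥0∞) :
    ∑' y : t, s.indicator (fun _ => a) (y : Y) = a * ((s ∩ t).encard : ℝ≥0∞) := by
  rw [← ENNReal.tsum_set_one, ← ENNReal.tsum_mul_left, tsum_subtype t (s.indicator fun _ => a),
    tsum_subtype (s ∩ t) (fun _ => a * 1)]
  refine tsum_congr fun y => ?_
  by_cases h1 : y ∈ t <;> by_cases h2 : y ∈ s <;> simp [h1, h2]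

theorem tsum_iSup_of_monotone {ι : Type*} {f : ℕ → ι → ℝ≥0∞} (hf : Monotone f) :
    ∑' i, (⨆ n, f n i) = ⨆ n, ∑' i, f n i := by
  simp_rw [ENNReal.tsum_eq_iSup_sum]
  rw [iSup_comm]
  refine iSup_congr fun s => ?_
  exact ENNReal.finsetSum_iSup_of_monotone fun i m n hmn => hf hmn i

variable {X Y : Type*} [MetricSpace X] [CompactSpace X] [MeasurableSpace X] [BorelSpace X]
  [TopologicalSpace Y] [PolishSpace Y] [MeasurableSpace Y] [BorelSpace Y]
  (μ : Measure X) [IsFiniteMeasure μ] {g : Y → X} (hg : Continuous g) {B : Set Y}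
  (hB : MeasurableSet B) {w : X → ℝ≥0∞} (hw : AEMeasurable w μ) {ν : Measure Y}
  (hν : ∀ E, MeasurableSet E →
    ν E = ∫⁻ x, w x * (((E ∩ B) ∩ g ⁻¹' {x}).encard : ℝ≥0∞) ∂μ)

include hg hB hw hν

/-- Enlarge the exceptional set to a Borel null set: the integral of its weighted fibre counts is
zero, and as `w` has no zeros, almost every fibre misses it. -/
theorem ae_fiber_of_ae (hw0 : ∀ x, w x ≠ 0) {P : Y → Prop} (hP : ∀ᵐ y ∂ν, P y) :
    ∀ᵐ x ∂μ, ∀ y ∈ B ∩ g ⁻¹' {x}, P y := by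
  obtain ⟨N, hPN, hN, hN0⟩ := exists_measurable_superset_of_null hP
  rw [hν N hN] at hN0
  have hN1 := (lintegral_eq_zero_iff'
    (hw.fun_mul (aemeasurable_fiber_encard μ hg (hN.inter hB)))).1 hN0
  filter_upwards [hN1] with x hx y hy
  simp only [Pi.zero_apply, mul_eq_zero, hw0 x, false_or] at hx
  have hx' : (N ∩ B ∩ g ⁻¹' {x}) = ∅ := by
    rw [← Set.encard_eq_zero]
    exact_mod_cast hx
  by_contra hPy
  exact (eq_empty_iff_forall_notMem.1 hx' y) ⟨⟨hPN hPy, hy.1⟩, hy.2⟩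

/-- The formula for `ν E` is the case of indicators, and the general case follows by sums and
monotone limits. Measurability of the fibre sums is carried through the induction because these two
steps need it. -/
theorem lintegral_fiber_of_measurable {F : Y → ℝ≥0∞} (hF : Measurable F) :
    AEMeasurable (fun x => ∑' y : (B ∩ g ⁻¹' {x} : Set Y), F y) μ ∧
      ∫⁻ y, F y ∂ν = ∫⁻ x, w x * ∑' y : (B ∩ g ⁻¹' {x} : Set Y), F y ∂μ := by
  refine Measurable.ennreal_induction (motive := fun F =>
    AEMeasurable (fun x => ∑' y : (B ∩ g ⁻¹' {x} : Set Y), F y) μ ∧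
      ∫⁻ y, F y ∂ν = ∫⁻ x, w x * ∑' y : (B ∩ g ⁻¹' {x} : Set Y), F y ∂μ) ?_ ?_ ?_ hF
  · intro a s hs
    have h := aemeasurable_fiber_encard μ hg (hs.inter hB)
    simp_rw [tsum_indicator_const_eq_mul_encard, ← inter_assoc]
    refine ⟨h.const_mul a, ?_⟩
    rw [lintegral_indicator_const hs, hν s hs, ← lintegral_const_mul'' _ (hw.fun_mul h)]
    exact lintegral_congr fun x => by ring
  · intro f h _ hf _ ihf ihh
    simp only [Pi.add_apply, ENNReal.tsum_add]
    refine ⟨ihf.1.add ihh.1, ?_⟩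
    rw [lintegral_add_left hf, ihf.2, ihh.2, ← lintegral_add_left' (hw.fun_mul ihf.1)]
    exact lintegral_congr fun x => (mul_add _ _ _).symm
  · intro f hf hmono ih
    have e : ∀ x, ∑' y : (B ∩ g ⁻¹' {x} : Set Y), (⨆ n, f n (y : Y)) =
        ⨆ n, ∑' y : (B ∩ g ⁻¹' {x} : Set Y), f n y := by
      intro x
      exact tsum_iSup_of_monotone (f := fun n (y : (B ∩ g ⁻¹' {x} : Set Y)) => f n y)
        fun m n hmn y => hmono hmn y
    simp_rw [e]
    refine ⟨AEMeasurable.iSup fun n => (ih n).1, ?_⟩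
    simp_rw [ENNReal.mul_iSup]
    rw [lintegral_iSup hf hmono, lintegral_iSup' fun n => hw.fun_mul (ih n).1]
    · exact iSup_congr fun n => (ih n).2
    · refine Eventually.of_forall fun x m n hmn => ?_
      dsimp only
      gcongr
      exact hmono hmn _

/-- Integration with respect to a measure that is disintegrated into weighted counting measures
on the fibres of a continuous map. -/
theorem lintegral_fiber (hw0 : ∀ x, w x ≠ 0) {F : Y → ℝ≥0∞} (hF : AEMeasurable F ν) :
    AEMeasurable (fun x => ∑' y : (B ∩ g ⁻¹' {x} : Set Y), F y) μ ∧
      ∫⁻ y, F y ∂ν = ∫⁻ x, w x * ∑' y : (B ∩ g ⁻¹' {x} : Set Y), F y ∂μ := by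
  obtain ⟨h1, h2⟩ := lintegral_fiber_of_measurable μ hg hB hw hν hF.measurable_mk
  have h3 : (fun x => ∑' y : (B ∩ g ⁻¹' {x} : Set Y), F y) =ᵐ[μ]
      fun x => ∑' y : (B ∩ g ⁻¹' {x} : Set Y), hF.mk F y := by
    filter_upwards [ae_fiber_of_ae μ hg hB hw hν hw0 hF.ae_eq_mk] with x hx
    exact tsum_congr fun y => hx y y.2
  refine ⟨h1.congr h3.symm, ?_⟩
  rw [lintegral_congr_ae hF.ae_eq_mk, h2]
  refine lintegral_congr_ae ?_
  filter_upwards [h3] with x hx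
  rw [hx]

end FiberIntegral

/-! ### Strong invariance as a disintegration -/

section StrongInvariance

variable {X : Type u} [MetricSpace X] [CompactSpace X] [MeasurableSpace X] [BorelSpace X]
  {r : C(X, X)} (hr_fin : ∀ x, (r ⁻¹' {x}).Finite) {ρ : Measure X} [IsProbabilityMeasure ρ]

theorem aemeasurable_card_fiber (r : C(X, X)) (ρ : Measure X) [IsProbabilityMeasure ρ] :
    AEMeasurable (fun x => ((r ⁻¹' {x}).encard : ℝ≥0∞)) ρ := by
  simpa using aemeasurable_fiber_encard ρ r.continuous MeasurableSet.univ

include hr_fin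

omit [CompactSpace X] [MeasurableSpace X] [BorelSpace X] in
theorem encard_fiber_ne_top (x : X) : ((r ⁻¹' {x}).encard : ℝ≥0∞) ≠ ⊤ := by
  simpa using hr_fin x

omit [CompactSpace X] [MeasurableSpace X] [BorelSpace X] in
theorem encard_fiber_eq_ncard (x : X) :
    ((r ⁻¹' {x}).encard : ℝ≥0∞) = ((r ⁻¹' {x}).ncard : ℝ≥0∞) := by
  rw [← (hr_fin x).cast_ncard_eq]; rfl

/-- A strongly invariant measure is disintegrated into the normalized counting measures on the
fibres of the map. -/
theorem IsStronglyInvariant.measure_eq (hρ : IsStronglyInvariant r ρ) {E : Set X}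
    (hE : MeasurableSet E) : ρ E = ∫⁻ x, ((r ⁻¹' {x}).encard : ℝ≥0∞)⁻¹ *
      (((E ∩ univ) ∩ r ⁻¹' {x}).encard : ℝ≥0∞) ∂ρ := by
  have h := hρ (E.indicator 1) (measurable_one.indicator hE) ⟨1, fun x => by
    by_cases hx : x ∈ E <;> simp [hx]⟩
  have hfin : ∀ x, (E ∩ r ⁻¹' {x}).Finite := fun x => (hr_fin x).subset inter_subset_right
  let F : X → ℝ≥0∞ := fun x => ((r ⁻¹' {x}).encard : ℝ≥0∞)⁻¹ *
      (((E ∩ univ) ∩ r ⁻¹' {x}).encard : ℝ≥0∞)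
  have hF : AEMeasurable F ρ := (aemeasurable_card_fiber r ρ).inv.mul
    (aemeasurable_fiber_encard ρ r.continuous (hE.inter MeasurableSet.univ))
  -- This keeps all integrals finite, so the complex identity can be read back in `ℝ≥0∞`.
  have hF1 : ∀ x, F x ≤ 1 := by
    intro x
    refine le_trans ?_ (ENNReal.inv_mul_le_one ((r ⁻¹' {x}).encard : ℝ≥0∞))
    simp only [F]
    gcongr
    exact inter_subset_right
  have e : ∀ x, (((r ⁻¹' {x}).ncard : ℂ))⁻¹ * ∑ᶠ y ∈ r ⁻¹' {x}, E.indicator (1 : X → ℂ) y =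
      ((F x).toReal : ℂ) := by
    intro x
    have h1 : ∑ᶠ y ∈ r ⁻¹' {x}, E.indicator (1 : X → ℂ) y = ((E ∩ r ⁻¹' {x}).ncard : ℂ) := by
      classical
      rw [finsum_mem_eq_finite_toFinset_sum _ (hr_fin x), Set.ncard_eq_toFinset_card _ (hfin x)]
      have : (hfin x).toFinset = (hr_fin x).toFinset.filter (· ∈ E) := by
        ext y; simp [and_comm]
      rw [this, Finset.card_filter]
      push_cast
      exact Finset.sum_congr rfl fun y _ => by simp [indicator_apply]
    have h2 : (((E ∩ univ) ∩ r ⁻¹' {x}).encard : ℝ≥0∞) = ((E ∩ r ⁻¹' {x}).ncard : ℝ≥0∞) := by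
      rw [inter_univ, ← (hfin x).cast_ncard_eq]; rfl
    simp only [F]
    rw [h1, h2, encard_fiber_eq_ncard hr_fin]
    simp
  simp_rw [e] at h
  rw [integral_complex_ofReal, integral_toReal hF (Eventually.of_forall fun x =>
    (hF1 x).trans_lt ENNReal.one_lt_top), integral_indicator hE] at h
  simp only [Pi.one_apply, integral_const, MeasurableSet.univ, measureReal_restrict_apply,
    univ_inter] at h
  have h' : (ρ E).toReal = (∫⁻ x, F x ∂ρ).toReal := by
    have : ((ρ E).toReal : ℂ) = ((∫⁻ x, F x ∂ρ).toReal : ℂ) := by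
      simpa [Measure.real] using h
    exact_mod_cast this
  have hFi : ∫⁻ x, F x ∂ρ ≠ ⊤ := by
    refine ne_top_of_le_ne_top (b := ∫⁻ x, 1 ∂ρ) (by simp) (lintegral_mono hF1)
  exact (ENNReal.toReal_eq_toReal_iff' (measure_ne_top _ _) hFi).1 h'

theorem IsStronglyInvariant.lintegral_eq (hρ : IsStronglyInvariant r ρ) {F : X → ℝ≥0∞}
    (hF : AEMeasurable F ρ) : ∫⁻ y, F y ∂ρ =
      ∫⁻ x, ((r ⁻¹' {x}).encard : ℝ≥0∞)⁻¹ * ∑' y : (r ⁻¹' {x} : Set X), F y ∂ρ := by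
  have h := (lintegral_fiber (w := fun x => ((r ⁻¹' {x}).encard : ℝ≥0∞)⁻¹) ρ r.continuous MeasurableSet.univ (aemeasurable_card_fiber r ρ).inv
    (fun E hE => hρ.measure_eq hr_fin hE)
    (fun x => ENNReal.inv_ne_zero.2 (encard_fiber_ne_top hr_fin x)) hF).2
  refine h.trans (lintegral_congr fun x => ?_)
  rw [univ_inter]

/-- A fibre of `r` over `x` lies inside `r ⁻¹' E` or misses it, so its normalized count is the
indicator of `E` at `x`. This is what allows composing functions that are only almost everywhere
measurable with `r`. -/
theorem IsStronglyInvariant.measurePreserving (hr : Function.Surjective r)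
    (hρ : IsStronglyInvariant r ρ) : MeasurePreserving r ρ ρ := by
  refine ⟨r.continuous.measurable, Measure.ext fun E hE => ?_⟩
  rw [Measure.map_apply r.continuous.measurable hE,
    hρ.measure_eq hr_fin (r.continuous.measurable hE), ← lintegral_indicator_one hE]
  refine lintegral_congr fun x => ?_
  by_cases hx : x ∈ E
  · have : (r ⁻¹' E ∩ univ ∩ r ⁻¹' {x}) = r ⁻¹' {x} := by
      rw [inter_univ]
      refine inter_eq_right.2 fun y hy => ?_
      rw [mem_preimage, mem_singleton_iff] at hy
      simpa [hy] using hx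
    rw [this, indicator_of_mem hx, Pi.one_apply]
    refine ENNReal.inv_mul_cancel ?_ (encard_fiber_ne_top hr_fin x)
    obtain ⟨y, hy⟩ := hr x
    have : (r ⁻¹' {x}).encard ≠ 0 := Set.encard_ne_zero.2 ⟨y, hy⟩
    exact_mod_cast this
  · have : (r ⁻¹' E ∩ univ ∩ r ⁻¹' {x}) = ∅ := by
      refine eq_empty_iff_forall_notMem.2 fun y hy => hx ?_
      have h1 : r y ∈ E := hy.1.1
      have h2 : r y = x := hy.2
      rwa [h2] at h1
    rw [this]
    simp [hx]

end StrongInvariance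

end Solenoid

namespace Solenoid

/-! ### Unitary weighted composition operators -/

section WeightedComposition

variable {Y : Type u} [MeasurableSpace Y] {μ : Measure Y} {σ : Y ≃ᵐ Y} {a : Y → ℂ}

theorem eLpNorm_two_eq_of_lintegral_eq {f g : Y → ℂ}
    (h : ∫⁻ y, ‖f y‖ₑ ^ 2 ∂μ = ∫⁻ y, ‖g y‖ₑ ^ 2 ∂μ) : eLpNorm f 2 μ = eLpNorm g 2 μ := by
  simp only [eLpNorm_eq_lintegral_rpow_enorm_toReal (two_ne_zero) (ENNReal.ofNat_ne_top),
    ENNReal.toReal_ofNat, ENNReal.rpow_ofNat, h]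

variable (ha : AEStronglyMeasurable a μ) (ha0 : ∀ y, a y ≠ 0)
  (hσ : ∀ E, MeasurableSet E → ∫⁻ y in σ ⁻¹' E, ‖a y‖ₑ ^ 2 ∂μ = μ E)

include hσ in
theorem measurePreserving_withDensity :
    MeasurePreserving σ (μ.withDensity fun y => ‖a y‖ₑ ^ 2) μ := by
  refine ⟨σ.measurable, Measure.ext fun E hE => ?_⟩
  rw [Measure.map_apply σ.measurable hE, withDensity_apply _ (σ.measurable hE), hσ E hE]

include ha ha0 hσ

/-- As `a` has no zeros, `μ` is absolutely continuous with respect to `|a|² μ`, which `σ` carries to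
`μ`. Hence composition with `σ` makes sense on classes modulo null sets. -/
theorem quasiMeasurePreserving_of_density : Measure.QuasiMeasurePreserving σ μ μ := by
  refine ⟨σ.measurable, ?_⟩
  have h1 : μ ≪ μ.withDensity fun y => ‖a y‖ₑ ^ 2 :=
    withDensity_absolutelyContinuous' (ha.enorm.pow_const 2)
      (Eventually.of_forall fun y => by simpa using ha0 y)
  have h2 := h1.map σ.measurable
  rwa [(measurePreserving_withDensity hσ).map_eq] at h2

omit ha ha0 in
theorem quasiMeasurePreserving_symm_of_density :
    Measure.QuasiMeasurePreserving σ.symm μ μ := by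
  refine ⟨σ.symm.measurable, ?_⟩
  rw [((measurePreserving_withDensity hσ).symm σ).map_eq]
  exact withDensity_absolutelyContinuous _ _

omit ha0 in
theorem lintegral_weightedComp {ξ : Y → ℂ} (hξ : AEStronglyMeasurable (ξ ∘ σ) μ) :
    ∫⁻ y, ‖a y * ξ (σ y)‖ₑ ^ 2 ∂μ = ∫⁻ y, ‖ξ y‖ₑ ^ 2 ∂μ := by
  rw [← (measurePreserving_withDensity hσ).lintegral_comp_emb σ.measurableEmbedding
      (fun y => ‖ξ y‖ₑ ^ 2),
    lintegral_withDensity_eq_lintegral_mul₀ (ha.enorm.pow_const 2)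
      (g := fun y => ‖ξ (σ y)‖ₑ ^ 2) (hξ.enorm.pow_const 2)]
  refine lintegral_congr fun y => ?_
  simp [enorm_mul, mul_pow]

theorem memLp_weightedComp (ξ : Lp ℂ 2 μ) : MemLp (fun y => a y * ξ (σ y)) 2 μ := by
  have hq := quasiMeasurePreserving_of_density ha ha0 hσ
  have hξ : AEStronglyMeasurable (ξ ∘ σ) μ :=
    (Lp.aestronglyMeasurable ξ).comp_quasiMeasurePreserving hq
  refine ⟨ha.mul hξ, ?_⟩
  rw [eLpNorm_two_eq_of_lintegral_eq (lintegral_weightedComp ha hσ hξ)]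
  exact Lp.eLpNorm_lt_top ξ

/-- A weighted composition operator that preserves the `L²` norm is unitary. -/
theorem exists_unitary_weightedComp : ∃ U : unitary (L2Operators μ), ∀ (ξ : Lp ℂ 2 μ) (g : Y → ℂ),
    ξ =ᵐ[μ] g → (U : L2Operators μ) ξ =ᵐ[μ] fun y => a y * g (σ y) := by
  have hq := quasiMeasurePreserving_of_density ha ha0 hσ
  have hm := memLp_weightedComp ha ha0 hσ
  let W : Lp ℂ 2 μ →ₗᵢ[ℂ] Lp ℂ 2 μ :=
    { toFun := fun ξ => (hm ξ).toLp _
      map_add' := fun ξ η => by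
        refine Lp.ext ?_
        filter_upwards [(hm (ξ + η)).coeFn_toLp, (hm ξ).coeFn_toLp, (hm η).coeFn_toLp,
          Lp.coeFn_add ((hm ξ).toLp _) ((hm η).toLp _), hq.ae (Lp.coeFn_add ξ η)]
          with y h1 h2 h3 h4 h5
        rw [h1, h4, Pi.add_apply, h2, h3, h5, Pi.add_apply, mul_add]
      map_smul' := fun t ξ => by
        refine Lp.ext ?_
        filter_upwards [(hm (t • ξ)).coeFn_toLp, (hm ξ).coeFn_toLp,
          Lp.coeFn_smul t ((hm ξ).toLp _), hq.ae (Lp.coeFn_smul t ξ)] with y h1 h2 h3 h4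
        rw [RingHom.id_apply, h1, h3, Pi.smul_apply, h2, h4, Pi.smul_apply, smul_eq_mul,
          smul_eq_mul, mul_left_comm]
      norm_map' := fun ξ => by
        change ‖(hm ξ).toLp _‖ = ‖ξ‖
        rw [Lp.norm_toLp, Lp.norm_def]
        congr 1
        exact eLpNorm_two_eq_of_lintegral_eq (lintegral_weightedComp ha hσ
          ((Lp.aestronglyMeasurable ξ).comp_quasiMeasurePreserving hq)) }
  have hW : ∀ ξ : Lp ℂ 2 μ, W ξ =ᵐ[μ] fun y => a y * ξ (σ y) := fun ξ => (hm ξ).coeFn_toLp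
  have hsurj : Function.Surjective W := by
    intro η
    have hq' := quasiMeasurePreserving_symm_of_density hσ
    -- The preimage of `η`, obtained by solving `a · (ξ ∘ σ) = η`.
    let ξ : Y → ℂ := fun y => (a (σ.symm y))⁻¹ * η (σ.symm y)
    have hξ1 : AEStronglyMeasurable ξ μ :=
      ((ha.aemeasurable.inv.aestronglyMeasurable.mul
        (Lp.aestronglyMeasurable η)).comp_quasiMeasurePreserving hq')
    have hξ2 : ∀ y, a y * ξ (σ y) = η y := fun y => by
      simp [ξ, mul_inv_cancel_left₀ (ha0 y)]
    have hξ : MemLp ξ 2 μ := by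
      refine ⟨hξ1, ?_⟩
      rw [← eLpNorm_two_eq_of_lintegral_eq (lintegral_weightedComp ha hσ
        (hξ1.comp_quasiMeasurePreserving hq))]
      simp_rw [hξ2]
      exact Lp.eLpNorm_lt_top η
    refine ⟨hξ.toLp ξ, Lp.ext ?_⟩
    filter_upwards [hW (hξ.toLp ξ), hq.ae hξ.coeFn_toLp] with y h1 h2
    rw [h1, h2, hξ2]
  refine ⟨Unitary.linearIsometryEquiv.symm (LinearIsometryEquiv.ofSurjective W hsurj),
    fun ξ g hg => ?_⟩
  change W ξ =ᵐ[μ] _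
  filter_upwards [hW ξ, hq.ae hg] with y h1 h2
  rw [h1, h2]

end WeightedComposition

/-! ### The multiplication representation -/

section Multiplication

variable {Y : Type u} [TopologicalSpace Y] [CompactSpace Y] [MeasurableSpace Y] [BorelSpace Y]

theorem mulOp_ext {μ : Measure Y} {f : C(Y, ℂ)} {T : L2Operators μ}
    (h : ∀ ξ : Lp ℂ 2 μ, T ξ =ᵐ[μ] fun y => f y * ξ y) : mulOp μ f = T :=
  ContinuousLinearMap.ext fun ξ => Lp.ext ((coeFn_mulOp μ f ξ).trans (h ξ).symm)

/-- The representation of `C(Y)` on `L²(μ)` by multiplication operators. -/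
noncomputable def mulRep (μ : Measure Y) : C(Y, ℂ) →⋆ₐ[ℂ] L2Operators μ where
  toFun := mulOp μ
  map_one' := mulOp_ext fun ξ => Eventually.of_forall fun y => by simp
  map_mul' f g := mulOp_ext fun ξ => by
    filter_upwards [coeFn_mulOp μ f (mulOp μ g ξ), coeFn_mulOp μ g ξ] with y h1 h2
    change mulOp μ f (mulOp μ g ξ) y = _
    rw [h1, h2, ContinuousMap.mul_apply, mul_assoc]
  map_zero' := mulOp_ext fun ξ => by
    filter_upwards [Lp.coeFn_zero ℂ 2 μ] with y h1
    change ((0 : Lp ℂ 2 μ) : Y → ℂ) y = (0 : C(Y, ℂ)) y * ξ y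
    rw [h1]
    simp
  map_add' f g := mulOp_ext fun ξ => by
    filter_upwards [coeFn_mulOp μ f ξ, coeFn_mulOp μ g ξ,
      Lp.coeFn_add (mulOp μ f ξ) (mulOp μ g ξ)] with y h1 h2 h3
    change (mulOp μ f ξ + mulOp μ g ξ : Lp ℂ 2 μ) y = _
    rw [h3, Pi.add_apply, h1, h2, ContinuousMap.add_apply, add_mul]
  commutes' t := mulOp_ext fun ξ => by
    filter_upwards [Lp.coeFn_smul t ξ] with y h1
    simpa [Algebra.algebraMap_eq_smul_one] using h1
  map_star' f := by
    rw [ContinuousLinearMap.star_eq_adjoint, ContinuousLinearMap.eq_adjoint_iff]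
    intro ξ η
    rw [L2.inner_def, L2.inner_def]
    refine integral_congr_ae ?_
    filter_upwards [coeFn_mulOp μ (star f) ξ, coeFn_mulOp μ f η] with y h1 h2
    rw [h1, h2]
    simp
    ring

end Multiplication

end Solenoid

namespace Solenoid

/-! ### Positivity of matrices of continuous functions -/

section MatrixPositivity

open scoped ComplexOrder InnerProductSpace

variable {Y : Type*} [TopologicalSpace Y]
  {H : Type*} [NormedAddCommGroup H] [InnerProductSpace ℂ H] [CompleteSpace H]
  {ι : Type*} [Fintype ι] [DecidableEq ι]

theorem inner_map_map_eq (π : C(Y, ℂ) →⋆ₐ[ℂ] (H →L[ℂ] H)) (f g : C(Y, ℂ)) (u v : H) :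
    ⟪π f u, π g v⟫_ℂ = ⟪u, π (star f * g) v⟫_ℂ := by
  rw [map_mul, map_star, ContinuousLinearMap.star_eq_adjoint, mul_apply_eq_comp,
    ContinuousLinearMap.adjoint_inner_right]

theorem norm_map_sq_eq_inner (π : C(Y, ℂ) →⋆ₐ[ℂ] (H →L[ℂ] H)) (f : C(Y, ℂ)) (u : H) :
    ((‖π f u‖ ^ 2 : ℝ) : ℂ) = ⟪u, π (star f * f) u⟫_ℂ := by
  rw [← inner_map_map_eq, inner_self_eq_norm_sq_to_K]
  simp

-- The quadratic form of `star x * x` under the amplification of `π` to matrices is a sum of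
-- squares; this turns positivity in the matrix algebra into norm inequalities in `H`.
omit [DecidableEq ι] in
theorem sum_norm_sq_eq_sum_inner (π : C(Y, ℂ) →⋆ₐ[ℂ] (H →L[ℂ] H))
    (x : CStarMatrix ι ι C(Y, ℂ)) (h : ι → H) :
    ((∑ l, ‖∑ k, π (x l k) (h k)‖ ^ 2 : ℝ) : ℂ) =
      ∑ j, ∑ k, ⟪h j, π ((star x * x) j k) (h k)⟫_ℂ := by
  have e : ∀ l, ((‖∑ k, π (x l k) (h k)‖ ^ 2 : ℝ) : ℂ) =
      ∑ j, ∑ k, ⟪h j, π (star (x l j) * x l k) (h k)⟫_ℂ := by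
    intro l
    have := inner_self_eq_norm_sq_to_K (𝕜 := ℂ) (∑ k, π (x l k) (h k))
    push_cast
    refine this.symm.trans ?_
    rw [sum_inner]
    refine Finset.sum_congr rfl fun j _ => ?_
    rw [inner_sum]
    exact Finset.sum_congr rfl fun k _ => inner_map_map_eq π _ _ _ _
  rw [Complex.ofReal_sum, Finset.sum_congr rfl fun l _ => e l, Finset.sum_comm]
  refine Finset.sum_congr rfl fun j _ => ?_
  rw [Finset.sum_comm]
  refine Finset.sum_congr rfl fun k _ => ?_
  rw [CStarMatrix.mul_apply, map_sum, sum_apply, inner_sum]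
  rfl

omit [DecidableEq ι] in
theorem sum_inner_star_mul_self_sub (π : C(Y, ℂ) →⋆ₐ[ℂ] (H →L[ℂ] H))
    (a b : CStarMatrix ι ι C(Y, ℂ)) (h : ι → H) :
    ∑ j, ∑ k, ⟪h j, π ((star a * a - star b * b) j k) (h k)⟫_ℂ =
      ((∑ l, ‖∑ k, π (a l k) (h k)‖ ^ 2 - ∑ l, ‖∑ k, π (b l k) (h k)‖ ^ 2 : ℝ) : ℂ) := by
  rw [Complex.ofReal_sub, sum_norm_sq_eq_sum_inner π a h, sum_norm_sq_eq_sum_inner π b h,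
    ← Finset.sum_sub_distrib]
  refine Finset.sum_congr rfl fun j _ => ?_
  rw [← Finset.sum_sub_distrib]
  refine Finset.sum_congr rfl fun k _ => ?_
  rw [← inner_sub_right, ← sub_apply, ← map_sub]
  rfl

theorem sum_norm_sq_scalar (π : C(Y, ℂ) →⋆ₐ[ℂ] (H →L[ℂ] H)) (S : ℝ) (h : ι → H) :
    ∑ l, ‖∑ k, π (CStarMatrix.ofMatrix (Matrix.diagonal fun _ : ι => algebraMap ℂ C(Y, ℂ) S) l k)
      (h k)‖ ^ 2 = S ^ 2 * ∑ j, ‖h j‖ ^ 2 := by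
  rw [Finset.mul_sum]
  refine Finset.sum_congr rfl fun n _ => ?_
  rw [Finset.sum_eq_single n]
  · rw [CStarMatrix.ofMatrix_apply, Matrix.diagonal_apply_eq, AlgHomClass.commutes,
      Algebra.algebraMap_eq_smul_one]
    simp [norm_smul, mul_pow]
  · intro j _ hj
    rw [CStarMatrix.ofMatrix_apply, Matrix.diagonal_apply_ne _ hj.symm]
    simp
  · simp

/-- The hypothesis says that the real spectrum has no negative points, and a self-adjoint element
with non-negative spectrum is a square. -/
theorem exists_eq_star_mul_self_of_isUnit {A : Type*} [CStarAlgebra A] {a : A}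
    (ha : IsSelfAdjoint a) (h : ∀ t : ℝ, t < 0 → IsUnit (algebraMap ℂ A t - a)) :
    ∃ b, a = star b * b := by
  let _ := CStarAlgebra.spectralOrder A
  let _ := CStarAlgebra.spectralOrderedRing A
  rw [← CStarAlgebra.nonneg_iff_eq_star_mul_self,
    StarOrderedRing.nonneg_iff_spectrum_nonneg (R := ℝ) a ha]
  intro t ht
  by_contra hneg
  exact ht (h t (not_le.1 hneg))

variable [CompactSpace Y]

/-- A matrix of continuous functions which is positive at every point is positive. -/
theorem exists_eq_star_mul_self_of_forall_point (P : CStarMatrix ι ι C(Y, ℂ))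
    (hP : IsSelfAdjoint P)
    (h : ∀ (y : Y) (c : ι → ℂ), 0 ≤ (∑ i, ∑ j, star (c i) * (P i j y * c j)).re) :
    ∃ x, P = star x * x := by
  refine exists_eq_star_mul_self_of_isUnit hP fun t hneg => ?_
  let Q : Matrix ι ι C(Y, ℂ) := CStarMatrix.ofMatrix.symm (algebraMap ℂ _ (t : ℂ) - P)
  have hQy : ∀ y i j, Q i j y = (if i = j then (t : ℂ) else 0) - P i j y := by
    intro y i j
    change (algebraMap ℂ (CStarMatrix ι ι C(Y, ℂ)) t i j - P i j) y = _
    rw [CStarMatrix.algebraMap_apply]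
    split_ifs <;> simp
  -- Over a commutative ring invertibility is that of the determinant, and a continuous function is
  -- invertible when it has no zeros. A zero at `y` would give an eigenvector of `P` at `y` for the
  -- negative eigenvalue `t`.
  have hQ : IsUnit Q := by
    rw [Matrix.isUnit_iff_isUnit_det, ContinuousMap.isUnit_iff_forall_ne_zero]
    intro y hy
    have hdet : (Q.map fun f => f y).det = 0 := by
      rw [← hy]
      exact ((ContinuousMap.evalStarAlgHom ℂ ℂ y).toRingHom.map_det Q).symm
    obtain ⟨v, hv0, hv⟩ := Matrix.exists_mulVec_eq_zero_iff.2 hdet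
    have h1 : ∀ i, (t : ℂ) * v i = ∑ j, P i j y * v j := by
      intro i
      have := congrFun hv i
      simp only [Matrix.mulVec, dotProduct, Matrix.map_apply, hQy, sub_mul,
        Finset.sum_sub_distrib, ite_mul, zero_mul, Finset.sum_ite_eq, Finset.mem_univ, if_true,
        Pi.zero_apply] at this
      exact sub_eq_zero.1 this
    have h2 := h y v
    simp_rw [← Finset.mul_sum, ← h1] at h2
    have h3 : (∑ i, star (v i) * ((t : ℂ) * v i)) = ((t * ∑ i, ‖v i‖ ^ 2 : ℝ) : ℂ) := by
      push_cast
      rw [Finset.mul_sum]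
      refine Finset.sum_congr rfl fun i _ => ?_
      rw [mul_left_comm, ← Complex.conj_mul']
      rfl
    rw [h3, Complex.ofReal_re] at h2
    obtain ⟨i, hi⟩ := Function.ne_iff.1 hv0
    have h4 : 0 < ∑ i, ‖v i‖ ^ 2 :=
      Finset.sum_pos' (fun i _ => by positivity) ⟨i, Finset.mem_univ i, by
        have : v i ≠ 0 := hi
        positivity⟩
    nlinarith
  exact hQ.map (CStarMatrix.ofMatrixRingEquiv : Matrix ι ι C(Y, ℂ) ≃+* CStarMatrix ι ι C(Y, ℂ))

/-- The norm of a matrix of continuous functions in a representation is at most the supremum of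
the norms at the points. -/
theorem sum_norm_sq_le_of_forall_point (π : C(Y, ℂ) →⋆ₐ[ℂ] (H →L[ℂ] H)) (g : ι → ι → C(Y, ℂ))
    (S : ℝ) (hg : ∀ (y : Y) (c : ι → ℂ), ∑ n, ‖∑ j, g n j y * c j‖ ^ 2 ≤ S ^ 2 * ∑ j, ‖c j‖ ^ 2)
    (h : ι → H) : ∑ n, ‖∑ j, π (g n j) (h j)‖ ^ 2 ≤ S ^ 2 * ∑ j, ‖h j‖ ^ 2 := by
  let G : CStarMatrix ι ι C(Y, ℂ) := CStarMatrix.ofMatrix g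
  let A : CStarMatrix ι ι C(Y, ℂ) :=
    CStarMatrix.ofMatrix (Matrix.diagonal fun _ => algebraMap ℂ C(Y, ℂ) S)
  have hP : ∃ x, star A * A - star G * G = star x * x := by
    refine exists_eq_star_mul_self_of_forall_point _
      ((IsSelfAdjoint.star_mul_self A).sub (IsSelfAdjoint.star_mul_self G)) fun y c => ?_
    -- Evaluation at `y`, acting on `ℂ`: the quadratic form identity for this representation is the
    -- pointwise hypothesis `hg`. The same identity for `π` then gives the conclusion.
    let πy : C(Y, ℂ) →⋆ₐ[ℂ] (ℂ →L[ℂ] ℂ) :=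
      (StarAlgHom.ofId ℂ (ℂ →L[ℂ] ℂ)).comp (ContinuousMap.evalStarAlgHom ℂ ℂ y)
    have hπy : ∀ (f : C(Y, ℂ)) (t : ℂ), πy f t = f y * t := by
      intro f t
      change (algebraMap ℂ (ℂ →L[ℂ] ℂ) (f y)) t = _
      rw [Algebra.algebraMap_eq_smul_one]
      simp
    have h1 := sum_inner_star_mul_self_sub πy A G c
    rw [sum_norm_sq_scalar] at h1
    simp_rw [hπy] at h1
    have h2 : ∑ i, ∑ j, star (c i) * ((star A * A - star G * G) i j y * c j) =
        ∑ i, ∑ j, ⟪c i, (star A * A - star G * G) i j y * c j⟫_ℂ := by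
      refine Finset.sum_congr rfl fun i _ => Finset.sum_congr rfl fun j _ => ?_
      rw [RCLike.inner_apply, mul_comm]
      rfl
    rw [h2, h1, Complex.ofReal_re]
    exact sub_nonneg.2 (hg y c)
  obtain ⟨x, hx⟩ := hP
  have h1 := sum_inner_star_mul_self_sub π A G h
  rw [hx, ← sum_norm_sq_eq_sum_inner π x h, Complex.ofReal_inj, sum_norm_sq_scalar] at h1
  have h2 : 0 ≤ ∑ l, ‖∑ k, π (x l k) (h k)‖ ^ 2 := Finset.sum_nonneg fun _ _ => by positivity
  rw [h1] at h2
  exact sub_nonneg.1 h2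

end MatrixPositivity

end Solenoid

namespace Solenoid

/-! ### Norm estimates in covariant representations -/

section CovariantReps

open scoped InnerProductSpace

variable {Y : Type u} [TopologicalSpace Y] {σ : Y ≃ₜ Y}

namespace CovariantRep

variable (R : CovariantRep σ)

/-- The powers of the unitary of a covariant representation, as operators. -/
noncomputable def pow (k : ℤ) : R.H →L[ℂ] R.H :=
  ((R.V ^ k : unitary (R.H →L[ℂ] R.H)) : R.H →L[ℂ] R.H)

theorem pow_add (k l : ℤ) : R.pow (k + l) = R.pow k * R.pow l := by
  simp [pow, zpow_add]

theorem pow_zero : R.pow 0 = 1 := by simp [pow]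

theorem pow_apply_pow (k l : ℤ) (h : R.H) : R.pow k (R.pow l h) = R.pow (k + l) h := by
  rw [pow_add]; rfl

theorem norm_pow (k : ℤ) (h : R.H) : ‖R.pow k h‖ = ‖h‖ := Unitary.norm_map (R.V ^ k) h

theorem inner_pow_pow (k : ℤ) (u v : R.H) : ⟪R.pow k u, R.pow k v⟫_ℂ = ⟪u, v⟫_ℂ :=
  Unitary.inner_map_map (R.V ^ k) u v

theorem star_pow (k : ℤ) : star (R.pow k) = R.pow (-k) := by
  rw [pow, pow, zpow_neg, ← Unitary.coe_star, Unitary.star_eq_inv]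

/-- The composition of a function with a power of the dynamics. -/
noncomputable def comp (σ : Y ≃ₜ Y) (k : ℤ) (f : C(Y, ℂ)) : C(Y, ℂ) := f.comp ((σ ^ k : Y ≃ₜ Y) : C(Y, Y))

theorem comp_apply (k : ℤ) (f : C(Y, ℂ)) (y : Y) : comp σ k f y = f ((σ ^ k : Y ≃ₜ Y) y) := rfl

theorem comp_comp (k l : ℤ) (f : C(Y, ℂ)) : comp σ k (comp σ l f) = comp σ (l + k) f := by
  ext y
  rw [comp_apply, comp_apply, comp_apply, zpow_add]
  rfl

theorem comp_zero (f : C(Y, ℂ)) : comp σ 0 f = f := by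
  ext y
  rw [comp_apply, zpow_zero]
  rfl

theorem pow_one_mul (f : C(Y, ℂ)) : R.pow 1 * R.π f = R.π (comp σ 1 f) * R.pow 1 := by
  have h : comp σ 1 f = f.comp (σ : C(Y, Y)) := by rw [comp, zpow_one]
  rw [h, ← R.covariance f, pow, zpow_one, mul_assoc, mul_assoc, Unitary.coe_star_mul_self,
    mul_one]

theorem pow_mul (k : ℤ) (f : C(Y, ℂ)) : R.pow k * R.π f = R.π (comp σ k f) * R.pow k := by
  induction k using Int.induction_on generalizing f with
  | zero => rw [pow_zero, comp_zero, one_mul, mul_one]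
  | succ n ih =>
    rw [pow_add, mul_assoc, pow_one_mul, ← mul_assoc, ih, mul_assoc, comp_comp, add_comm 1]
  | pred n ih =>
    -- The relation for `V`, taken at `g ∘ σ⁻¹` and multiplied by `V⁻¹` on both sides.
    have h1 : ∀ g : C(Y, ℂ), R.pow (-1) * R.π g = R.π (comp σ (-1) g) * R.pow (-1) := by
      intro g
      have h2 := R.pow_one_mul (comp σ (-1) g)
      rw [comp_comp, neg_add_cancel, comp_zero] at h2
      calc R.pow (-1) * R.π g = R.pow (-1) * (R.π g * R.pow 1) * R.pow (-1) := by
            rw [mul_assoc, mul_assoc, ← pow_add, add_neg_cancel, pow_zero, mul_one]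
        _ = _ := by
            rw [← h2, ← mul_assoc, ← pow_add, neg_add_cancel, pow_zero, one_mul]
    rw [sub_eq_add_neg, pow_add, mul_assoc, h1, ← mul_assoc, ih, mul_assoc, comp_comp,
      add_comm (-1)]

theorem pow_map (k : ℤ) (f : C(Y, ℂ)) (h : R.H) :
    R.pow k (R.π f h) = R.π (comp σ k f) (R.pow k h) :=
  congrArg (fun T : R.H →L[ℂ] R.H => T h) (R.pow_mul k f)

/-- The operator `∑ π(f_k) V^k`. -/
noncomputable def eval (f : ℤ →₀ C(Y, ℂ)) : R.H →L[ℂ] R.H := f.sum fun k g => R.π g * R.pow k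

theorem eval_apply (f : ℤ →₀ C(Y, ℂ)) (h : R.H) :
    R.eval f h = ∑ k ∈ f.support, R.π (f k) (R.pow k h) := by
  rw [eval, Finsupp.sum, sum_apply]
  rfl

/-- Replaces the sum over the support by a window of integers under `j ↦ j - n` or `n ↦ j - n`;
extra indices carry zero coefficients. -/
theorem sum_support_eq_sum {M : Type*} [AddCommMonoid M] (f : ℤ →₀ C(Y, ℂ)) (F : ℤ → M)
    (hF : ∀ k, f k = 0 → F k = 0) {e : ℤ → ℤ} (he : Function.Injective e) (J : Finset ℤ)
    (hJ : ∀ k ∈ f.support, ∃ j ∈ J, e j = k) : ∑ k ∈ f.support, F k = ∑ j ∈ J, F (e j) := by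
  rw [← Finset.sum_image (s := J) (g := e) (f := F) he.injOn]
  exact Finset.sum_subset (fun k hk => Finset.mem_image.2 (hJ k hk))
    fun k _ hk => hF k (Finsupp.notMem_support_iff.1 hk)

theorem exists_support_bound (f : ℤ →₀ C(Y, ℂ)) :
    ∃ K : ℕ, ∀ k ∈ f.support, -(K : ℤ) ≤ k ∧ k ≤ K := by
  refine ⟨f.support.sup Int.natAbs, fun k hk => ?_⟩
  have := Finset.le_sup (f := Int.natAbs) hk
  omega

variable [CompactSpace Y]

theorem sum_finset_norm_sq_le_of_forall_point {H : Type*} [NormedAddCommGroup H]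
    [InnerProductSpace ℂ H] [CompleteSpace H] (π : C(Y, ℂ) →⋆ₐ[ℂ] (H →L[ℂ] H)) (J : Finset ℤ)
    (g : ℤ → ℤ → C(Y, ℂ)) (S : ℝ)
    (hg : ∀ (y : Y) (c : ℤ → ℂ), ∑ n ∈ J, ‖∑ j ∈ J, g n j y * c j‖ ^ 2 ≤ S ^ 2 * ∑ j ∈ J, ‖c j‖ ^ 2)
    (h : ℤ → H) : ∑ n ∈ J, ‖∑ j ∈ J, π (g n j) (h j)‖ ^ 2 ≤ S ^ 2 * ∑ j ∈ J, ‖h j‖ ^ 2 := by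
  have key := sum_norm_sq_le_of_forall_point (ι := J) π (fun n j => g n j) S (by
    intro y c
    let c' : ℤ → ℂ := fun j => if hj : j ∈ J then c ⟨j, hj⟩ else 0
    have hc' : ∀ j : J, c j = c' j := fun j => by simp [c']
    simp_rw [hc']
    rw [Finset.sum_coe_sort J (fun j => ‖c' j‖ ^ 2),
      Finset.sum_coe_sort J (fun n => ‖∑ j : J, g n j y * c' j‖ ^ 2)]
    simp_rw [fun n => Finset.sum_coe_sort J (fun j => g n j y * c' j)]
    exact hg y c') (fun j => h j)
  rw [Finset.sum_coe_sort J (fun j => ‖h j‖ ^ 2),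
      Finset.sum_coe_sort J (fun n => ‖∑ j : J, π (g n j) (h j)‖ ^ 2)] at key
  simp_rw [fun n => Finset.sum_coe_sort J (fun j => π (g n j) (h j))] at key
  exact key

/-- Amenability of `ℤ`: an operator `∑ π(f_k) V^k` is bounded by the compressions of the regular
representations at the points of the space. -/
theorem norm_eval_apply_le (f : ℤ →₀ C(Y, ℂ)) {S : ℝ} (hS : 0 ≤ S)
    (hf : ∀ (M : ℕ) (y : Y) (c : ℤ → ℂ),
      ∑ n ∈ Finset.Icc (-(M : ℤ)) M,
        ‖∑ j ∈ Finset.Icc (-(M : ℤ)) M, comp σ n (f (j - n)) y * c j‖ ^ 2 ≤ S ^ 2 * ∑ j ∈ Finset.Icc (-(M : ℤ)) M, ‖c j‖ ^ 2) (h : R.H) :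
    ‖R.eval f h‖ ≤ S * ‖h‖ := by
  obtain ⟨K, hK⟩ := exists_support_bound f
  have key : ∀ N : ℕ, (2 * N + 1 : ℝ) * ‖R.eval f h‖ ^ 2 ≤
      S ^ 2 * ((2 * (N + K) + 1) * ‖h‖ ^ 2) := by
    intro N
    let J := Finset.Icc (-((N + K : ℕ) : ℤ)) ((N + K : ℕ) : ℤ)
    -- A Følner argument: the matrix bound is applied to the orbit segment `(V^j h)`. For `|n| ≤ N`
    -- the window contains the whole shifted support, so row `n` yields `V^n` applied to the
    -- operator's value at `h`. The other `2K` rows are dropped.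
    have hA := sum_finset_norm_sq_le_of_forall_point R.π J (fun n j => comp σ n (f (j - n))) S
      (hf (N + K)) (fun j => R.pow j h)
    simp_rw [norm_pow] at hA
    have hcard : (J.card : ℝ) = 2 * (N + K) + 1 := by
      rw [Int.card_Icc]
      have : (((N + K : ℕ) : ℤ) + 1 - -((N + K : ℕ) : ℤ)).toNat = 2 * (N + K) + 1 := by omega
      rw [this]
      push_cast
      ring
    rw [Finset.sum_const, nsmul_eq_mul, hcard] at hA
    refine le_trans ?_ hA
    have hsub : Finset.Icc (-(N : ℤ)) N ⊆ J := Finset.Icc_subset_Icc (by simp) (by simp)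
    refine le_trans ?_ (Finset.sum_le_sum_of_subset_of_nonneg hsub fun _ _ _ => by positivity)
    have hn : ∀ n ∈ Finset.Icc (-(N : ℤ)) N,
        ‖∑ j ∈ J, R.π (comp σ n (f (j - n))) (R.pow j h)‖ ^ 2 = ‖R.eval f h‖ ^ 2 := by
      intro n hn
      rw [Finset.mem_Icc] at hn
      rw [← R.norm_pow n (R.eval f h), eval_apply, map_sum]
      congr 2
      rw [sum_support_eq_sum f (fun k => R.pow n (R.π (f k) (R.pow k h)))
        (fun k hk => by simp [hk]) (sub_left_injective (b := n)) J]
      · refine Finset.sum_congr rfl fun j _ => ?_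
        rw [pow_map, pow_apply_pow, add_sub_cancel]
      · intro k hk
        have := hK k hk
        refine ⟨n + k, ?_, by ring⟩
        rw [Finset.mem_Icc]
        omega
    rw [Finset.sum_congr rfl hn, Finset.sum_const, Int.card_Icc, nsmul_eq_mul]
    have : ((N : ℤ) + 1 - -(N : ℤ)).toNat = 2 * N + 1 := by omega
    rw [this]
    push_cast
    exact le_rfl
  refine le_of_sq_le_sq ?_ (by positivity)
  rw [mul_pow]
  by_contra hlt
  rw [not_le] at hlt
  -- `key N` bounds `(2N+1)(‖R.eval f h‖² - S²‖h‖²)` by `2K S²‖h‖²`, which fails for large `N` if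
  -- the difference is positive.
  obtain ⟨N, hN⟩ := exists_nat_gt (2 * K * (S ^ 2 * ‖h‖ ^ 2) / (‖R.eval f h‖ ^ 2 - S ^ 2 * ‖h‖ ^ 2))
  rw [div_lt_iff₀ (sub_pos.2 hlt)] at hN
  nlinarith [key N, sub_pos.2 hlt]

theorem norm_sum_sq_of_orthogonal {H : Type*} [NormedAddCommGroup H] [InnerProductSpace ℂ H]
    {s : Finset ℤ} {w : ℤ → H} (hw : ∀ i ∈ s, ∀ j ∈ s, i ≠ j → ⟪w i, w j⟫_ℂ = 0) :
    ‖∑ i ∈ s, w i‖ ^ 2 = ∑ i ∈ s, ‖w i‖ ^ 2 := by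
  have h1 : ((‖∑ i ∈ s, w i‖ ^ 2 : ℝ) : ℂ) = ((∑ i ∈ s, ‖w i‖ ^ 2 : ℝ) : ℂ) := by
    have := inner_self_eq_norm_sq_to_K (𝕜 := ℂ) (∑ i ∈ s, w i)
    push_cast
    refine this.symm.trans ?_
    rw [sum_inner]
    refine Finset.sum_congr rfl fun i hi => ?_
    rw [inner_sum, Finset.sum_eq_single_of_mem i hi fun j hj hji => hw i hi j hj hji.symm]
    exact inner_self_eq_norm_sq_to_K (𝕜 := ℂ) (w i)
  exact_mod_cast h1

-- Applying `V^n` to both entries moves all functions to one side, where the product `star φ · (φ ∘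
-- σ^(n-m))` vanishes.
omit [CompactSpace Y] in
theorem inner_pow_pow_eq_zero {φ : C(Y, ℂ)} {m n : ℤ}
    (hφ : ∀ y, φ y = 0 ∨ φ ((σ ^ (n - m) : Y ≃ₜ Y) y) = 0) (u v : R.H) :
    ⟪R.pow (-n) (R.π φ u), R.pow (-m) (R.π φ v)⟫_ℂ = 0 := by
  have h0 : star φ * comp σ (n - m) φ = 0 := by
    ext y
    rcases hφ y with h | h
    · simp [h]
    · simp [comp_apply, h]
  rw [← R.inner_pow_pow n, pow_apply_pow, pow_apply_pow, add_neg_cancel, pow_zero, pow_map,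
    one_apply_eq_self, inner_map_map_eq, ← sub_eq_add_neg, h0]
  simp

/-- A compression of the regular representation at a point without short periods is bounded by the
operator in a covariant representation that is faithful on the functions. -/
theorem sum_norm_sq_le_of_aperiodic [T2Space Y] (hπ : Function.Injective R.π) (f : ℤ →₀ C(Y, ℂ)) {K : ℕ}
    (hK : ∀ k ∈ f.support, -(K : ℤ) ≤ k ∧ k ≤ K) (M : ℕ) {y : Y}
    (hy : ∀ d : ℤ, d ≠ 0 → |d| ≤ (2 * (M + K) : ℕ) → (σ ^ d : Y ≃ₜ Y) y ≠ y) (c : ℤ → ℂ) :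
    ∑ n ∈ Finset.Icc (-(M : ℤ)) M,
        ‖∑ j ∈ Finset.Icc (-(M : ℤ)) M, comp σ n (f (j - n)) y * c j‖ ^ 2 ≤ ‖R.eval f‖ ^ 2 * ∑ j ∈ Finset.Icc (-(M : ℤ)) M, ‖c j‖ ^ 2 := by
  set J := Finset.Icc (-(M : ℤ)) M with hJ
  let L := Finset.Icc (-((M + K : ℕ) : ℤ)) ((M + K : ℕ) : ℤ)
  have hJL : J ⊆ L := Finset.Icc_subset_Icc (by simp) (by simp)
  -- The rows of the matrix applied to `c`, as functions of the point.
  let G : ℤ → C(Y, ℂ) := fun n => ∑ j ∈ J, c j • comp σ n (f (j - n))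
  have hG : ∀ n z, G n z = ∑ j ∈ J, comp σ n (f (j - n)) z * c j := by
    intro n z
    simp [G, ContinuousMap.sum_apply, mul_comm]
  simp_rw [← hG]
  by_contra hcon
  rw [not_le] at hcon
  obtain ⟨T, hT1, hT2⟩ := exists_between hcon
  -- A neighbourhood of `y` on which the row sum stays above `T` and which is disjoint from its
  -- translates by all non-zero `d` up to `2(M+K)`, the largest difference of two indices in `L`.
  obtain ⟨W, hWo, hyW, hWT, hWd⟩ : ∃ W : Set Y, IsOpen W ∧ y ∈ W ∧
      (∀ z ∈ W, T < ∑ n ∈ J, ‖G n z‖ ^ 2) ∧ ∀ d : ℤ, d ≠ 0 → |d| ≤ (2 * (M + K) : ℕ) →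
        ∀ z ∈ W, (σ ^ d : Y ≃ₜ Y) z ∉ W := by
    have hd : ∀ d : ℤ, ∃ W ∈ 𝓝 y, d ≠ 0 → |d| ≤ (2 * (M + K) : ℕ) →
        ∀ z ∈ W, (σ ^ d : Y ≃ₜ Y) z ∉ W := by
      intro d
      by_cases h : d ≠ 0 ∧ |d| ≤ (2 * (M + K) : ℕ)
      · obtain ⟨U, V, hU, hV, hyU, hyV, hUV⟩ := t2_separation (hy d h.1 h.2)
        refine ⟨(σ ^ d : Y ≃ₜ Y) ⁻¹' U ∩ V, inter_mem ((hU.preimage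
          (σ ^ d : Y ≃ₜ Y).continuous).mem_nhds hyU) (hV.mem_nhds hyV), fun _ _ z hz hz' => ?_⟩
        exact Set.disjoint_left.1 hUV hz.1 hz'.2
      · exact ⟨univ, univ_mem, fun h1 h2 => absurd ⟨h1, h2⟩ h⟩
    choose Wd hWd1 hWd2 using hd
    have hT : ∀ᶠ z in 𝓝 y, T < ∑ n ∈ J, ‖G n z‖ ^ 2 :=
      (continuous_finsetSum _ fun n _ => ((G n).continuous.norm.pow 2)).tendsto y |>.eventually
        (lt_mem_nhds hT2)
    obtain ⟨W, hW, hWo, hyW⟩ := mem_nhds_iff.1 (inter_mem hT ((Filter.biInter_finset_mem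
      (Finset.Icc (-((2 * (M + K) : ℕ) : ℤ)) ((2 * (M + K) : ℕ) : ℤ))).2 fun d _ => hWd1 d))
    refine ⟨W, hWo, hyW, fun z hz => (hW hz).1, fun d hd0 hd z hz hz' => ?_⟩
    have hdm := Finset.mem_Icc.2 (abs_le.1 hd)
    exact hWd2 d hd0 hd z (mem_iInter₂.1 (hW hz).2 d hdm) (mem_iInter₂.1 (hW hz').2 d hdm)
  obtain ⟨ψ, hψ0, hψ1, hψ⟩ := exists_continuous_zero_one_of_isClosed hWo.isClosed_compl
    (isClosed_singleton (x := y)) (Set.disjoint_singleton_right.2 fun h => h hyW)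
  let φ : C(Y, ℂ) := ⟨fun z => (ψ z : ℂ), Complex.continuous_ofReal.comp ψ.continuous⟩
  have hφ : ∀ z, φ z = (ψ z : ℂ) := fun z => rfl
  have hφW : ∀ z, z ∉ W → φ z = 0 := fun z hz => by
    rw [hφ, hψ0 hz]
    simp
  have hφ0 : R.π φ ≠ 0 := by
    intro h
    have h1 : φ = 0 := hπ (h.trans (map_zero _).symm)
    have h2 : φ y = 1 := by rw [hφ, hψ1 rfl]; simp
    rw [h1] at h2
    simp at h2
  obtain ⟨h, hh⟩ : ∃ h, R.π φ h ≠ 0 := by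
    by_contra hall
    push Not at hall
    exact hφ0 (ContinuousLinearMap.ext hall)
  have horth : ∀ u : ℤ → R.H, ∀ s ⊆ L, ‖∑ n ∈ s, R.pow (-n) (R.π φ (u n))‖ ^ 2 =
      ∑ n ∈ s, ‖R.π φ (u n)‖ ^ 2 := by
    intro u s hs
    rw [norm_sum_sq_of_orthogonal]
    · simp_rw [norm_pow]
    · intro n hn m hm hnm
      have hn' := Finset.mem_Icc.1 (hs hn)
      have hm' := Finset.mem_Icc.1 (hs hm)
      refine R.inner_pow_pow_eq_zero (fun z => ?_) _ _
      by_cases hz : z ∈ W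
      · refine Or.inr (hφW _ (hWd (n - m) (sub_ne_zero.2 hnm) (abs_le.2 ?_) z hz))
        push_cast at hn' hm' ⊢
        omega
      · exact Or.inl (hφW z hz)
  -- The copy of `c` localized near `y`. Its summands are orthogonal, and the operator sends it to
  -- the orthogonal sum of the `V^(-n) φ G_n h`, with `n` in the larger window `L`.
  let ξ : R.H := ∑ j ∈ J, R.pow (-j) (R.π φ (c j • h))
  have hξ : ‖ξ‖ ^ 2 = (∑ j ∈ J, ‖c j‖ ^ 2) * ‖R.π φ h‖ ^ 2 := by
    rw [horth _ J hJL, Finset.sum_mul]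
    refine Finset.sum_congr rfl fun j _ => ?_
    rw [map_smul, norm_smul, mul_pow]
  have hAξ : R.eval f ξ = ∑ n ∈ L, R.pow (-n) (R.π φ (R.π (G n) h)) := by
    have hj : ∀ j ∈ J, R.eval f (R.pow (-j) (R.π φ (c j • h))) =
        ∑ n ∈ L, c j • R.pow (-n) (R.π φ (R.π (comp σ n (f (j - n))) h)) := by
      intro j hj
      rw [eval_apply, sum_support_eq_sum f
        (fun k => R.π (f k) (R.pow k (R.pow (-j) (R.π φ (c j • h))))) (fun k hk => by simp [hk])
        (sub_right_injective (b := j)) L]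
      · refine Finset.sum_congr rfl fun n _ => ?_
        have h1 : R.π φ (R.π (comp σ n (f (j - n))) h) = R.π (comp σ n (f (j - n))) (R.π φ h) := by
          rw [← mul_apply_eq_comp, ← map_mul, mul_comm, map_mul, mul_apply_eq_comp]
        rw [h1, R.pow_map (-n), comp_comp, add_neg_cancel, comp_zero, pow_apply_pow, map_smul,
          map_smul, map_smul]
        congr 4
        ring
      · intro k hk
        have := hK k hk
        have := Finset.mem_Icc.1 hj
        refine ⟨j - k, Finset.mem_Icc.2 ?_, by ring⟩
        push_cast
        omega
    rw [map_sum, Finset.sum_congr rfl hj, Finset.sum_comm]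
    refine Finset.sum_congr rfl fun n _ => ?_
    simp only [G, map_sum, map_smul, sum_apply, smul_apply]
  have hlow : T * ‖R.π φ h‖ ^ 2 ≤ ∑ n ∈ J, ‖R.π φ (R.π (G n) h)‖ ^ 2 := by
    -- A square root of `|φ|² (∑ |G_n|² - T)`, which is non-negative because the bracket is positive
    -- on `W` and `φ` vanishes off `W`. The `max` keeps the radicand non-negative everywhere.
    let s : C(Y, ℂ) := ⟨fun z => (√(ψ z ^ 2 * max 0 (∑ n ∈ J, ‖G n z‖ ^ 2 - T)) : ℂ), by
      fun_prop⟩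
    have hs : ∑ n ∈ J, star (φ * G n) * (φ * G n) = (T : ℂ) • (star φ * φ) + star s * s := by
      ext z
      have h1 : star (s z) * s z = ((ψ z ^ 2 * (∑ n ∈ J, ‖G n z‖ ^ 2 - T) : ℝ) : ℂ) := by
        change star ((√_ : ℝ) : ℂ) * ((√_ : ℝ) : ℂ) = _
        rw [Complex.star_def, Complex.conj_ofReal, ← Complex.ofReal_mul,
          Real.mul_self_sqrt (by positivity)]
        by_cases hz : z ∈ W
        · rw [max_eq_right (sub_nonneg.2 (hWT z hz).le)]
        · rw [hψ0 hz]
          simp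
      have h2 : ∀ n, star (φ z * G n z) * (φ z * G n z) = ((ψ z ^ 2 * ‖G n z‖ ^ 2 : ℝ) : ℂ) := by
        intro n
        rw [Complex.star_def, Complex.conj_mul', norm_mul, hφ, Complex.norm_real,
          ← Complex.ofReal_pow, mul_pow, Real.norm_eq_abs, sq_abs]
      simp only [ContinuousMap.sum_apply, ContinuousMap.mul_apply, ContinuousMap.star_apply,
        ContinuousMap.add_apply, ContinuousMap.smul_apply, h1, h2]
      rw [hφ, Complex.star_def, Complex.conj_ofReal, smul_eq_mul, ← Complex.ofReal_sum,
        ← Finset.mul_sum]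
      push_cast
      ring
    have h3 : ((∑ n ∈ J, ‖R.π φ (R.π (G n) h)‖ ^ 2 : ℝ) : ℂ) =
        ((T * ‖R.π φ h‖ ^ 2 + ‖R.π s h‖ ^ 2 : ℝ) : ℂ) := by
      rw [Complex.ofReal_sum, Complex.ofReal_add, Complex.ofReal_mul, norm_map_sq_eq_inner R.π φ,
        norm_map_sq_eq_inner R.π s]
      simp_rw [← mul_apply_eq_comp, ← map_mul, norm_map_sq_eq_inner]
      rw [← inner_sum, ← sum_apply, ← map_sum, hs, map_add, map_smul, add_apply, smul_apply,
        inner_add_right, inner_smul_right]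
    rw [Complex.ofReal_inj.1 h3]
    linarith [sq_nonneg ‖R.π s h‖]
  have hpos : 0 < ‖R.π φ h‖ ^ 2 := by positivity
  have hup : T * ‖R.π φ h‖ ^ 2 ≤ (‖R.eval f‖ ^ 2 * ∑ j ∈ J, ‖c j‖ ^ 2) * ‖R.π φ h‖ ^ 2 := by
    calc T * ‖R.π φ h‖ ^ 2 ≤ ∑ n ∈ J, ‖R.π φ (R.π (G n) h)‖ ^ 2 := hlow
      _ ≤ ∑ n ∈ L, ‖R.π φ (R.π (G n) h)‖ ^ 2 :=
          Finset.sum_le_sum_of_subset_of_nonneg hJL fun _ _ _ => by positivity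
      _ = ‖R.eval f ξ‖ ^ 2 := by rw [hAξ, horth _ L subset_rfl]
      _ ≤ (‖R.eval f‖ * ‖ξ‖) ^ 2 := by
          gcongr
          exact (R.eval f).le_opNorm ξ
      _ = _ := by rw [mul_pow, hξ, mul_assoc]
  exact absurd (le_of_mul_le_mul_right hup hpos) (not_le.2 hT1)

/-- A covariant representation that is faithful on the functions dominates all the others if the
dynamics is topologically free. -/
theorem norm_eval_le [T2Space Y] (hπ : Function.Injective R.π)
    (hfree : ∀ D : ℕ, Dense {y : Y | ∀ d : ℤ, d ≠ 0 → |d| ≤ D → (σ ^ d : Y ≃ₜ Y) y ≠ y})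
    (R' : CovariantRep σ) (f : ℤ →₀ C(Y, ℂ)) : ‖R'.eval f‖ ≤ ‖R.eval f‖ := by
  obtain ⟨K, hK⟩ := exists_support_bound f
  refine ContinuousLinearMap.opNorm_le_bound _ (norm_nonneg _)
    (R'.norm_eval_apply_le f (norm_nonneg _) fun M y c => ?_)
  -- For fixed `M` and `c` the estimate is a closed condition on `y`, so it passes from the dense
  -- set of points without short periods to all points.
  have hcl : IsClosed {y : Y | ∑ n ∈ Finset.Icc (-(M : ℤ)) M,
      ‖∑ j ∈ Finset.Icc (-(M : ℤ)) M, comp σ n (f (j - n)) y * c j‖ ^ 2 ≤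
        ‖R.eval f‖ ^ 2 * ∑ j ∈ Finset.Icc (-(M : ℤ)) M, ‖c j‖ ^ 2} :=
    isClosed_le (by fun_prop) continuous_const
  exact hcl.closure_subset_iff.2
    (fun y hy => R.sum_norm_sq_le_of_aperiodic hπ f hK M hy c) (hfree (2 * (M + K)) y)

end CovariantRep

end CovariantReps

end Solenoid

namespace Solenoid

/-! ### The universal representation -/

section Universal

variable {Y : Type u} [TopologicalSpace Y] [CompactSpace Y] {σ : Y ≃ₜ Y}

/-- The symbols with a fixed power, as an additive map. -/
noncomputable def familyHom (σ : Y ≃ₜ Y) (k : ℤ) : C(Y, ℂ) →+ BoundedFamilies σ where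
  toFun f := family σ f k
  map_zero' := Subtype.ext (funext fun R => by simp [family])
  map_add' f g := Subtype.ext (funext fun R => by
    change R.π (f + g) * _ = R.π f * _ + R.π g * _
    rw [map_add, add_mul])

/-- The linear combinations of the symbols. -/
noncomputable def familySum (σ : Y ≃ₜ Y) : (ℤ →₀ C(Y, ℂ)) →+ BoundedFamilies σ :=
  Finsupp.liftAddHom (familyHom σ)

/-- The component of a bounded family at a covariant representation. -/
def evalRep (R : CovariantRep σ) : BoundedFamilies σ →⋆ₐ[ℂ] (R.H →L[ℂ] R.H) where
  toFun x := x R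
  map_one' := rfl
  map_mul' _ _ := rfl
  map_zero' := rfl
  map_add' _ _ := rfl
  commutes' _ := rfl
  map_star' _ := rfl

theorem evalRep_family (R : CovariantRep σ) (f : C(Y, ℂ)) (k : ℤ) :
    evalRep R (family σ f k) = R.π f * R.pow k := rfl

theorem evalRep_familySum (R : CovariantRep σ) (f : ℤ →₀ C(Y, ℂ)) :
    evalRep R (familySum σ f) = R.eval f := by
  rw [familySum, Finsupp.liftAddHom_apply, Finsupp.sum, map_sum]
  rfl

omit [CompactSpace Y] in
theorem family_ext {x y : BoundedFamilies σ} (h : ∀ R, evalRep R x = evalRep R y) : x = y :=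
  Subtype.ext (funext h)

theorem family_mem (f : C(Y, ℂ)) (k : ℤ) : family σ f k ∈ AddMonoidHom.mrange (familySum σ) :=
  ⟨Finsupp.single k f, by
    rw [familySum, Finsupp.liftAddHom_apply_single]
    rfl⟩

theorem family_mul (f g : C(Y, ℂ)) (k l : ℤ) :
    family σ f k * family σ g l = family σ (f * CovariantRep.comp σ k g) (k + l) := by
  refine family_ext fun R => ?_
  rw [map_mul, evalRep_family, evalRep_family, evalRep_family, map_mul, R.pow_add, mul_assoc,
    ← mul_assoc (R.pow k), R.pow_mul, mul_assoc, mul_assoc]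

theorem star_family (f : C(Y, ℂ)) (k : ℤ) :
    star (family σ f k) = family σ (CovariantRep.comp σ (-k) (star f)) (-k) := by
  refine family_ext fun R => ?_
  rw [map_star, evalRep_family, evalRep_family, star_mul, R.star_pow, ← map_star, R.pow_mul]

/-- Products and adjoints of symbols are symbols, and scalars are symbols with `k = 0`. So finite
sums of symbols exhaust the generated *-algebra. -/
theorem adjoin_family_subset {x : BoundedFamilies σ}
    (hx : x ∈ StarAlgebra.adjoin ℂ {a | ∃ (f : C(Y, ℂ)) (k : ℤ), a = family σ f k}) :
    x ∈ AddMonoidHom.mrange (familySum σ) := by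
  induction hx using StarAlgebra.adjoin_induction with
  | mem x hx =>
    obtain ⟨f, k, rfl⟩ := hx
    exact family_mem f k
  | algebraMap t =>
    have : algebraMap ℂ (BoundedFamilies σ) t = family σ (algebraMap ℂ _ t) 0 := by
      refine family_ext fun R => ?_
      rw [evalRep_family, AlgHomClass.commutes, AlgHomClass.commutes, R.pow_zero, mul_one]
    rw [this]
    exact family_mem _ _
  | add x y _ _ hx hy => exact add_mem hx hy
  | mul x y _ _ hx hy =>
    obtain ⟨f, rfl⟩ := hx
    obtain ⟨g, rfl⟩ := hy
    rw [familySum, Finsupp.liftAddHom_apply, Finsupp.liftAddHom_apply, Finsupp.sum, Finsupp.sum,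
      Finset.sum_mul_sum]
    refine sum_mem fun k _ => sum_mem fun l _ => ?_
    change family σ (f k) k * family σ (g l) l ∈ _
    rw [family_mul]
    exact family_mem _ _
  | star x _ hx =>
    obtain ⟨f, rfl⟩ := hx
    rw [familySum, Finsupp.liftAddHom_apply, Finsupp.sum, star_sum]
    refine sum_mem fun k _ => ?_
    change star (family σ (f k) k) ∈ _
    rw [star_family]
    exact family_mem _ _

/-- For a topologically free dynamics, a covariant representation that is faithful on the functions
is faithful on the crossed product. -/
theorem injective_evalRep [T2Space Y] (R : CovariantRep σ) (hπ : Function.Injective R.π)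
    (hfree : ∀ D : ℕ, Dense {y : Y | ∀ d : ℤ, d ≠ 0 → |d| ≤ D → (σ ^ d : Y ≃ₜ Y) y ≠ y}) :
    Function.Injective ((evalRep R).comp (crossedProduct σ).subtype) := by
  have hcont : Continuous (evalRep R) :=
    AddMonoidHomClass.continuous_of_bound (evalRep R) 1 fun x => by
      rw [one_mul]
      exact lp.norm_apply_le_norm ENNReal.top_ne_zero x R
  -- A closed condition, so it suffices to check finite sums. Their norm is the supremum over all
  -- covariant representations, each of which is dominated by `R`.
  have hle : ∀ x ∈ crossedProduct σ, ‖x‖ ≤ ‖evalRep R x‖ := by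
    intro x hx
    refine closure_minimal (t := {x | ‖x‖ ≤ ‖evalRep R x‖}) ?_
      (isClosed_le continuous_norm hcont.norm) hx
    intro x hx
    obtain ⟨f, rfl⟩ := adjoin_family_subset hx
    refine lp.norm_le_of_forall_le (norm_nonneg _) fun R' => ?_
    change ‖evalRep R' (familySum σ f)‖ ≤ _
    rw [evalRep_familySum, evalRep_familySum]
    exact R.norm_eval_le hπ hfree R' f
  rw [injective_iff_map_eq_zero]
  intro x hx
  have h1 := hle x x.2
  change evalRep R x = 0 at hx
  rw [hx, norm_zero] at h1
  exact Subtype.ext (norm_le_zero_iff.1 h1)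

end Universal

end Solenoid

namespace Solenoid

/-! ### Dynamics of the shift on paths -/

section Dynamics

variable {X : Type u} {r : X → X}

theorem iterate_apply_path (z : PathSpace r) (m : ℕ) (n : ℤ) : r^[m] (z.1 n) = z.1 (n - m) := by
  induction m generalizing n with
  | zero => simp
  | succ m ih =>
    have h := z.2 (n - 1)
    rw [sub_add_cancel] at h
    rw [Function.iterate_succ_apply, h, ih]
    exact congrArg z.1 (by push_cast; ring)

theorem shift_apply [TopologicalSpace X] (z : PathSpace r) (n : ℤ) :
    (shift r z).1 n = z.1 (n - 1) := rfl

theorem shift_zpow_apply [TopologicalSpace X] (k : ℤ) (z : PathSpace r) (n : ℤ) :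
    ((shift r ^ k : PathSpace r ≃ₜ PathSpace r) z).1 n = z.1 (n - k) := by
  induction k using Int.induction_on generalizing z n with
  | zero => simp
  | succ k ih =>
    rw [zpow_add, zpow_one, Homeomorph.mul_apply, ih, shift_apply]
    exact congrArg z.1 (by ring)
  | pred k ih =>
    rw [sub_eq_add_neg, zpow_add, zpow_neg_one, Homeomorph.mul_apply, ih]
    exact congrArg z.1 (show n - -(k : ℤ) + 1 = n - (-(k : ℤ) + -1) by ring)

theorem IsCycle.map_eq {p : ℕ} [NeZero p] {c : Fin p → X} (hc : IsCycle r c) (i : Fin p) :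
    r (c i) = c (i - 1) := by
  have := hc.2 (i - 1)
  rwa [sub_add_cancel] at this

theorem IsCycle.iterate_mem_range {p : ℕ} [NeZero p] {c : Fin p → X} (hc : IsCycle r c) (m : ℕ)
    {x : X} (hx : x ∈ range c) : r^[m] x ∈ range c := by
  induction m with
  | zero => exact hx
  | succ m ih =>
    obtain ⟨i, hi⟩ := ih
    exact ⟨i - 1, by rw [Function.iterate_succ_apply', ← hi, hc.map_eq]⟩

/-- The paths that are attracted by the cycle. -/
def attracted [TopologicalSpace X] (r : X → X) {p : ℕ} (c : Fin p → X) : Set (PathSpace r) :=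
  {z | ∃ i, z ∈ convergesTo r c i}

theorem attracted_eq_iUnion [TopologicalSpace X] {p : ℕ} (c : Fin p → X) :
    attracted r c = ⋃ i, convergesTo r c i := by
  ext z
  simp [attracted]

theorem shift_mem_attracted [TopologicalSpace X] (hr : Continuous r) {p : ℕ} [NeZero p]
    {c : Fin p → X} (hc : IsCycle r c) {z : PathSpace r} (hz : z ∈ attracted r c) :
    shift r z ∈ attracted r c := by
  obtain ⟨i, hi⟩ := hz
  refine ⟨i - 1, ?_⟩
  have h1 : Tendsto (fun n : ℕ => r (z.1 (p * n : ℕ))) atTop (𝓝 (r (c i))) :=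
    (hr.tendsto _).comp hi
  rw [hc.map_eq] at h1
  refine h1.congr fun n => ?_
  rw [shift_apply]
  exact iterate_apply_path z 1 _

theorem shift_pow_mem_attracted_iff [TopologicalSpace X] {p : ℕ} {c : Fin p → X}
    (z : PathSpace r) :
    (shift r ^ (p : ℤ) : PathSpace r ≃ₜ PathSpace r) z ∈ attracted r c ↔ z ∈ attracted r c := by
  refine exists_congr fun i => ?_
  change Tendsto _ _ _ ↔ Tendsto _ _ _
  simp_rw [shift_zpow_apply]
  rw [← tendsto_add_atTop_iff_nat 1]
  exact tendsto_congr fun n => congrArg z.1 (by push_cast; ring)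

/-- For the converse: `p - 1` further shifts of an attracted path stay attracted, and `p` shifts
only delay the sequence `z_{pn}` by one step. -/
theorem shift_mem_attracted_iff [TopologicalSpace X] (hr : Continuous r) {p : ℕ} [NeZero p]
    {c : Fin p → X} (hc : IsCycle r c) (z : PathSpace r) :
    shift r z ∈ attracted r c ↔ z ∈ attracted r c := by
  refine ⟨fun h => ?_, shift_mem_attracted hr hc⟩
  have h1 : ∀ m : ℕ, (shift r ^ ((m + 1 : ℕ) : ℤ) : PathSpace r ≃ₜ PathSpace r) z ∈
      attracted r c := by
    intro m
    induction m with
    | zero => simpa using h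
    | succ m ih =>
      have := shift_mem_attracted hr hc ih
      rwa [← Homeomorph.mul_apply, ← zpow_one_add, add_comm] at this
  have h2 := h1 (p - 1)
  rw [Nat.sub_add_cancel (NeZero.one_le : 1 ≤ p)] at h2
  exact (shift_pow_mem_attracted_iff z).1 h2

/-- Every non-empty open set of paths contains a non-empty open cylinder. -/
theorem exists_cylinder_subset [TopologicalSpace X] (hr : Continuous r) {V : Set (PathSpace r)}
    (hV : IsOpen V) {y : PathSpace r} (hy : y ∈ V) :
    ∃ (n : ℤ) (W : Set X), IsOpen W ∧ y.1 n ∈ W ∧ ∀ z : PathSpace r, z.1 n ∈ W → z ∈ V := by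
  obtain ⟨V', hV', rfl⟩ := isOpen_induced_iff.1 hV
  obtain ⟨I, v, hv, hIV⟩ := isOpen_pi_iff.1 hV' y.1 hy
  -- A coordinate determines all earlier ones through iterates of `r`, so one late coordinate
  -- controls the finitely many in `I`.
  obtain ⟨n, hn⟩ : ∃ n : ℤ, ∀ i ∈ I, i ≤ n := I.exists_le
  have hz : ∀ (z : PathSpace r), ∀ i ∈ I, r^[(n - i).toNat] (z.1 n) = z.1 i := by
    intro z i hi
    rw [iterate_apply_path, Int.toNat_of_nonneg (sub_nonneg.2 (hn i hi)), sub_sub_cancel]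
  refine ⟨n, ⋂ i ∈ I, r^[(n - i).toNat] ⁻¹' v i, ?_, ?_, ?_⟩
  · exact isOpen_biInter_finset fun i hi => (hv i hi).1.preimage (hr.iterate _)
  · refine mem_iInter₂.2 fun i hi => ?_
    rw [mem_preimage, hz y i hi]
    exact (hv i hi).2
  · intro z h
    refine hIV fun i hi => ?_
    have := mem_iInter₂.1 h i hi
    rwa [mem_preimage, hz z i hi] at this

/-! ### Topological freeness -/

section TopologicallyFree

variable [TopologicalSpace X] [T2Space X] (hr : Continuous r) {p : ℕ} [NeZero p] {c : Fin p → X}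
  (hc : IsCycle r c) (hN : ∀ x, (cyclePaths r c x).Nonempty)

omit [T2Space X] in
theorem path_add_mul {d : ℤ} {z : PathSpace r}
    (hz : (shift r ^ d : PathSpace r ≃ₜ PathSpace r) z = z) (k : ℕ) (n : ℤ) :
    z.1 (n + k * d) = z.1 n := by
  induction k with
  | zero => simp
  | succ k ih =>
    rw [← ih]
    conv_lhs => rw [← hz, shift_zpow_apply]
    exact congrArg z.1 (by push_cast; ring)

omit [T2Space X] in
theorem shift_zpow_natAbs_eq {d : ℤ} {z : PathSpace r}
    (hz : (shift r ^ d : PathSpace r ≃ₜ PathSpace r) z = z) :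
    (shift r ^ (d.natAbs : ℤ) : PathSpace r ≃ₜ PathSpace r) z = z := by
  rcases Int.natAbs_eq d with h | h
  · rwa [← h]
  · rw [h, zpow_neg] at hz
    exact ((Homeomorph.eq_symm_apply _).1 hz.symm)

omit [NeZero p] in
/-- A periodic path that is attracted by the cycle starts in the cycle. -/
theorem mem_range_of_periodic {d : ℕ} (hd : d ≠ 0) {z : PathSpace r}
    (hz : (shift r ^ (d : ℤ) : PathSpace r ≃ₜ PathSpace r) z = z) (hzN : z ∈ attracted r c) :
    z.1 0 ∈ range c := by
  obtain ⟨i, hi⟩ := hzN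
  refine ⟨i, ?_⟩
  -- Along the indices `pdn` the path is constantly `z_0`, yet it converges to `c i`.
  have h1 : Tendsto (fun n : ℕ => d * n) atTop atTop :=
    tendsto_id.const_mul_atTop' (Nat.pos_of_ne_zero hd)
  have h2 : Tendsto (fun n : ℕ => z.1 ((p * (d * n) : ℕ) : ℤ)) atTop (𝓝 (c i)) := hi.comp h1
  refine tendsto_nhds_unique h2 ?_
  have h3 : (fun n : ℕ => z.1 ((p * (d * n) : ℕ) : ℤ)) = fun _ => z.1 0 := by
    funext n
    rw [← path_add_mul hz (p * n) 0]
    exact congrArg z.1 (by push_cast; ring)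
  rw [h3]
  exact tendsto_const_nhds

include hr hc hN

/-- If all paths that start in a non-empty open set are periodic with the same period, then the
map is injective. -/
theorem injective_of_periodic {W : Set X} (hW : IsOpen W) (hWne : W.Nonempty) {d : ℕ}
    (hd : d ≠ 0)
    (hper : ∀ z : PathSpace r, z.1 0 ∈ W →
      (shift r ^ (d : ℤ) : PathSpace r ≃ₜ PathSpace r) z = z) : Function.Injective r := by
  have hWc : W ⊆ range c := by
    intro x hx
    obtain ⟨z, hz, hz'⟩ := hN x
    have h0 : z.1 0 = x := hz
    rw [← h0]
    exact mem_range_of_periodic hd (hper z (by rwa [h0])) hz'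
  -- the property propagates backwards along the cycle
  let Q : Fin p → Prop := fun i => IsOpen ({c i} : Set X) ∧ ∀ z : PathSpace r, z.1 0 = c i →
    (shift r ^ (d : ℤ) : PathSpace r ≃ₜ PathSpace r) z = z
  have hstep : ∀ i, Q i → Q (i + 1) := by
    rintro i ⟨hi, hz⟩
    constructor
    · have : ({c (i + 1)} : Set X) = r ⁻¹' {c i} := by
        -- Put `y` at time `1` of a path with `c i` at time `0`; by periodicity it is also at time
        -- `1 - d`, reached from `c i` by `d - 1` steps of `r`.
        have huniq : ∀ y, r y = c i → y = r^[d - 1] (c i) := by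
          intro y hy
          obtain ⟨w, hw, -⟩ := hN y
          have hw0 : w.1 0 = y := hw
          have h0 : (shift r w).1 0 = c i := by
            rw [← hy, ← hw0]
            exact (iterate_apply_path w 1 0).symm
          have h1 : (shift r w).1 1 = y := by rw [shift_apply, ← hw0]; rfl
          rw [← h1, ← h0, iterate_apply_path, ← path_add_mul (hz _ h0) 1 (0 - ((d - 1 : ℕ) : ℤ))]
          exact congrArg (shift r w).1 (by push_cast [Nat.one_le_iff_ne_zero.2 hd]; ring)
        ext y
        rw [mem_singleton_iff, mem_preimage, mem_singleton_iff]
        constructor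
        · rintro rfl
          exact hc.2 i
        · intro hy
          rw [huniq y hy, huniq _ (hc.2 i)]
      rw [this]
      exact hi.preimage hr
    · intro w hw
      have h0 : (shift r w).1 0 = c i := by
        rw [← hc.2 i, ← hw]
        exact (iterate_apply_path w 1 0).symm
      have h1 := hz _ h0
      have h2 : shift r ((shift r ^ (d : ℤ) : PathSpace r ≃ₜ PathSpace r) w) = shift r w := by
        rw [← Homeomorph.mul_apply, ← zpow_one_add, add_comm, zpow_add_one, Homeomorph.mul_apply,
          h1]
      exact (shift r).injective h2
  obtain ⟨i₀, hi₀⟩ : ∃ i, Q i := by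
    obtain ⟨x, hx⟩ := hWne
    obtain ⟨i, hi⟩ := hWc hx
    refine ⟨i, ?_, fun z hz => hper z (by rwa [hz, hi])⟩
    have hfin : (W \ {x}).Finite := (finite_range c).subset (sdiff_subset.trans hWc)
    have : ({c i} : Set X) = W \ (W \ {x}) := by
      rw [Set.sdiff_sdiff_right_self, hi]
      exact (inter_eq_right.2 (singleton_subset_iff.2 hx)).symm
    rw [this]
    exact hW.sdiff hfin.isClosed
  have hQk : ∀ k : ℕ, Q (i₀ + Fin.ofNat p k) := by
    intro k
    induction k with
    | zero => simpa using hi₀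
    | succ k ih =>
      have h1 : Fin.ofNat p (k + 1) = Fin.ofNat p k + 1 := by
        ext
        simp [Fin.ofNat, Fin.val_add]
      rw [h1, ← add_assoc]
      exact hstep _ ih
  have hQ : ∀ j, Q j := by
    intro j
    have := hQk (j - i₀).val
    rwa [Fin.ofNat_val_eq_self, add_sub_cancel] at this
  have hrange : ∀ x, x ∈ range c := by
    intro x
    obtain ⟨z, hz, j, hj⟩ := hN x
    have h0 : z.1 0 = x := hz
    obtain ⟨n, hn⟩ := (hj.eventually ((hQ j).1.mem_nhds rfl)).exists
    have hn' : z.1 ((p * n : ℕ) : ℤ) = c j := hn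
    have := iterate_apply_path z (p * n) ((p * n : ℕ) : ℤ)
    rw [sub_self, h0, hn'] at this
    rw [← this]
    exact hc.iterate_mem_range _ ⟨j, rfl⟩
  intro x y hxy
  obtain ⟨i, rfl⟩ := hrange x
  obtain ⟨j, rfl⟩ := hrange y
  rw [hc.map_eq, hc.map_eq] at hxy
  rw [sub_left_injective (hc.1 hxy)]

/-- By Baire it suffices that, for each `d ≠ 0`, the closed set of paths fixed by `r̂^d` has no
interior. An open set inside it contains a cylinder, which a power of `r̂` moves to time `0`, where
`injective_of_periodic` applies. -/
theorem dense_aperiodic [BaireSpace (PathSpace r)] (hninj : ¬ Function.Injective r) (D : ℕ) :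
    Dense {y : PathSpace r | ∀ d : ℤ, d ≠ 0 → |d| ≤ D →
      (shift r ^ d : PathSpace r ≃ₜ PathSpace r) y ≠ y} := by
  have h1 : Dense (⋂ d : {d : ℤ // d ≠ 0},
      {y : PathSpace r | (shift r ^ (d : ℤ) : PathSpace r ≃ₜ PathSpace r) y ≠ y}) := by
    refine dense_iInter_of_isOpen (fun d => isOpen_ne_fun
      (shift r ^ (d : ℤ) : PathSpace r ≃ₜ PathSpace r).continuous continuous_id) ?_
    rintro ⟨d, hd⟩
    rw [dense_iff_inter_open]
    intro V hV ⟨y, hy⟩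
    by_contra hempty
    rw [not_nonempty_iff_eq_empty, eq_empty_iff_forall_notMem] at hempty
    have hVd : ∀ z ∈ V, (shift r ^ d : PathSpace r ≃ₜ PathSpace r) z = z := by
      intro z hz
      by_contra hne
      exact hempty z ⟨hz, hne⟩
    obtain ⟨n, W, hW, hyW, hWV⟩ := exists_cylinder_subset hr hV hy
    refine hninj (injective_of_periodic hr hc hN hW ⟨_, hyW⟩ (Int.natAbs_ne_zero.2 hd)
      fun z hz => shift_zpow_natAbs_eq ?_)
    have h2 := hVd ((shift r ^ n : PathSpace r ≃ₜ PathSpace r) z) (hWV _ (by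
      rwa [shift_zpow_apply, sub_self]))
    rw [← Homeomorph.mul_apply, ← zpow_add, add_comm, zpow_add, Homeomorph.mul_apply] at h2
    exact (shift r ^ n : PathSpace r ≃ₜ PathSpace r).injective h2
  refine h1.mono fun y hy d hd _ => ?_
  exact mem_iInter.1 hy ⟨d, hd⟩

end TopologicallyFree

end Dynamics

end Solenoid

namespace Solenoid

/-! ### The path measure and the weight -/

section PathMeasure

variable {X : Type u} [MetricSpace X] [CompactSpace X] [MeasurableSpace X] [BorelSpace X]
  (r : C(X, X)) (ρ : Measure X) [IsProbabilityMeasure ρ] {p : ℕ} (c : Fin p → X)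

instance polishSpace_pathSpace : PolishSpace (PathSpace r) := (isClosed_pathSpace r).polishSpace

omit [CompactSpace X] [MeasurableSpace X] [BorelSpace X] in
theorem continuous_start (r : C(X, X)) : Continuous fun z : PathSpace r => z.1 0 :=
  (continuous_apply 0).comp continuous_subtype_val

omit [CompactSpace X] in
theorem measurableSet_convergesTo (i : Fin p) : MeasurableSet (convergesTo r c i) :=
  measurableSet_tendsto (𝓝 (c i)) (f := fun (n : ℕ) (z : PathSpace r) => z.1 ((p * n : ℕ) : ℤ))
    fun _ => (measurable_pi_apply _).comp measurable_subtype_coe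

omit [CompactSpace X] in
theorem measurableSet_attracted : MeasurableSet (attracted r c) := by
  rw [attracted_eq_iUnion]
  exact MeasurableSet.iUnion fun i => measurableSet_convergesTo r c i

omit [CompactSpace X] [MeasurableSpace X] [BorelSpace X] in
theorem limitIndex_eq_iff [NeZero p] {c : Fin p → X} (hc : IsCycle r c) (i : Fin p)
    (z : PathSpace r) : limitIndex r c z = i ↔
      z ∈ convergesTo r c i ∨ (z ∉ attracted r c ∧ i = 0) := by
  by_cases h : ∃ j, z ∈ convergesTo r c j
  · rw [limitIndex, dif_pos h]
    constructor
    · rintro rfl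
      exact Or.inl h.choose_spec
    · rintro (hi | ⟨hi, -⟩)
      · exact hc.1 (tendsto_nhds_unique h.choose_spec hi)
      · exact absurd h hi
  · rw [limitIndex, dif_neg h]
    constructor
    · rintro rfl
      exact Or.inr ⟨h, rfl⟩
    · rintro (hi | ⟨-, hi⟩)
      · exact absurd ⟨i, hi⟩ h
      · exact hi.symm

omit [CompactSpace X] in
theorem measurable_limitIndex [NeZero p] {c : Fin p → X} (hc : IsCycle r c) :
    Measurable (limitIndex r c) := by
  refine measurable_to_countable' fun i => ?_
  have : limitIndex r c ⁻¹' {i} =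
      convergesTo r c i ∪ ((attracted r c)ᶜ ∩ {_z | i = 0}) := by
    ext z
    exact limitIndex_eq_iff r hc i z
  rw [this]
  exact (measurableSet_convergesTo r c i).union
    ((measurableSet_attracted r c).compl.inter (MeasurableSet.const _))

theorem pathMeasure_apply {E : Set (PathSpace r)} (hE : MeasurableSet E) :
    pathMeasure r ρ c E = ∫⁻ x, 1 * (((E ∩ attracted r c) ∩
      (fun z : PathSpace r => z.1 0) ⁻¹' {x}).encard : ℝ≥0∞) ∂ρ := by
  rw [pathMeasure, Measure.ofMeasurable_apply _ hE]
  simp_rw [one_mul, tsum_cyclePaths]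
  rfl

theorem ae_start_of_ae {P : PathSpace r → Prop} (hP : ∀ᵐ z ∂(pathMeasure r ρ c), P z) :
    ∀ᵐ x ∂ρ, ∀ z ∈ attracted r c ∩ (fun z : PathSpace r => z.1 0) ⁻¹' {x}, P z :=
  ae_fiber_of_ae ρ (continuous_start r) (measurableSet_attracted r c) aemeasurable_const
    (fun _ hE => pathMeasure_apply r ρ c hE) (fun _ => one_ne_zero) hP

theorem lintegral_pathMeasure {F : PathSpace r → ℝ≥0∞} (hF : AEMeasurable F (pathMeasure r ρ c)) :
    ∫⁻ z, F z ∂(pathMeasure r ρ c) = ∫⁻ x, ∑' z : (attracted r c ∩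
      (fun z : PathSpace r => z.1 0) ⁻¹' {x} : Set (PathSpace r)), F z ∂ρ := by
  rw [(lintegral_fiber ρ (continuous_start r) (measurableSet_attracted r c) aemeasurable_const
    (fun _ hE => pathMeasure_apply r ρ c hE) (fun _ => one_ne_zero) hF).2]
  simp_rw [one_mul]

/-- A null set of starting points contributes nothing to the integral. Needed to lift fibre
cardinalities, which are only almost everywhere measurable on `X`, to paths. -/
theorem quasiMeasurePreserving_start :
    Measure.QuasiMeasurePreserving (fun z : PathSpace r => z.1 0) (pathMeasure r ρ c) ρ := by
  refine ⟨(continuous_start r).measurable, Measure.AbsolutelyContinuous.mk fun A hA hA0 => ?_⟩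
  rw [Measure.map_apply (continuous_start r).measurable hA,
    pathMeasure_apply r ρ c ((continuous_start r).measurable hA)]
  refine (lintegral_congr_ae ?_).trans lintegral_zero
  filter_upwards [measure_eq_zero_iff_ae_notMem.1 hA0] with x hx
  have : ((fun z : PathSpace r => z.1 0) ⁻¹' A ∩ attracted r c) ∩
      (fun z : PathSpace r => z.1 0) ⁻¹' {x} = ∅ := by
    refine eq_empty_iff_forall_notMem.2 fun z hz => hx ?_
    have h1 : z.1 0 = x := hz.2
    rw [← h1]
    exact hz.1.1
  rw [this]
  simp

theorem encard_eq_tsum_indicator {Y : Type*} (s : Set Y) :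
    (s.encard : ℝ≥0∞) = ∑' y, s.indicator (fun _ => (1 : ℝ≥0∞)) y := by
  rw [← ENNReal.tsum_set_one, tsum_subtype s (fun _ => (1 : ℝ≥0∞))]

variable {r ρ c}

omit [CompactSpace X] [MeasurableSpace X] [BorelSpace X] in
/-- The attracted paths that start at `x` are, up to the shift, the attracted paths that start at
the preimages of `x`. -/
theorem tsum_encard_shift [NeZero p] (hc : IsCycle r c) (E : Set (PathSpace r)) (x : X) :
    ∑' y : (r ⁻¹' {x} : Set X), (((shift r ⁻¹' E ∩ attracted r c) ∩
      (fun z : PathSpace r => z.1 0) ⁻¹' {(y : X)}).encard : ℝ≥0∞) =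
      (((E ∩ attracted r c) ∩ (fun z : PathSpace r => z.1 0) ⁻¹' {x}).encard : ℝ≥0∞) := by
  simp_rw [encard_eq_tsum_indicator]
  rw [ENNReal.tsum_comm, ← (shift r).toEquiv.tsum_eq
    ((E ∩ attracted r c ∩ (fun z : PathSpace r => z.1 0) ⁻¹' {x}).indicator fun _ => (1 : ℝ≥0∞))]
  refine tsum_congr fun z => ?_
  have h0 : (shift r z).1 0 = r (z.1 0) := (iterate_apply_path z 1 0).symm
  have hN := shift_mem_attracted_iff r.continuous hc z
  by_cases h : shift r z ∈ E ∩ attracted r c ∩ (fun z : PathSpace r => z.1 0) ⁻¹' {x}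
  · have hx : r (z.1 0) = x := by rw [← h0]; exact h.2
    -- Each path is counted once, at its own starting point.
    rw [tsum_eq_single ⟨z.1 0, hx⟩]
    · rw [indicator_of_mem, Homeomorph.coe_toEquiv, indicator_of_mem h]
      exact ⟨⟨h.1.1, hN.1 h.1.2⟩, rfl⟩
    · intro y hy
      refine indicator_of_notMem (fun hz => hy (Subtype.ext ?_)) _
      have : z.1 0 = y := hz.2
      exact this.symm
  · rw [Homeomorph.coe_toEquiv, indicator_of_notMem h, ENNReal.tsum_eq_zero]
    intro y
    refine indicator_of_notMem (fun hz => h ⟨⟨hz.1.1, hN.2 hz.1.2⟩, ?_⟩) _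
    have h1 : z.1 0 = y := hz.2
    have h2 : r (y : X) = x := y.2
    show (shift r z).1 0 = x
    rw [h0, h1, h2]

section Density

variable (hr_surj : Function.Surjective r) (hr_fin : ∀ x, (r ⁻¹' {x}).Finite)
  (hρ : IsStronglyInvariant r ρ)

include hr_surj hr_fin hρ

theorem aemeasurable_card_fiber_comp :
    AEMeasurable (fun x => ((r ⁻¹' {r x}).encard : ℝ≥0∞)) ρ :=
  (aemeasurable_card_fiber r ρ).comp_quasiMeasurePreserving
    (hρ.measurePreserving hr_fin hr_surj).quasiMeasurePreserving

/-- The density of the path measure with respect to its image under the inverse shift. -/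
theorem lintegral_shift_preimage [NeZero p] (hc : IsCycle r c) {E : Set (PathSpace r)}
    (hE : MeasurableSet E) :
    ∫⁻ z in shift r ⁻¹' E, ((r ⁻¹' {r (z.1 0)}).encard : ℝ≥0∞) ∂(pathMeasure r ρ c) =
      pathMeasure r ρ c E := by
  have hE' : MeasurableSet (shift r ⁻¹' E) := (shift r).continuous.measurable hE
  have hv := aemeasurable_card_fiber_comp hr_surj hr_fin hρ
  have hvz : AEMeasurable (fun z : PathSpace r => ((r ⁻¹' {r (z.1 0)}).encard : ℝ≥0∞))
      (pathMeasure r ρ c) := hv.comp_quasiMeasurePreserving (quasiMeasurePreserving_start r ρ c)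
  let e : X → ℝ≥0∞ := fun x => (((shift r ⁻¹' E ∩ attracted r c) ∩
      (fun z : PathSpace r => z.1 0) ⁻¹' {x}).encard : ℝ≥0∞)
  have he : AEMeasurable e ρ := aemeasurable_fiber_encard ρ (continuous_start r)
    (hE'.inter (measurableSet_attracted r c))
  rw [← lintegral_indicator hE', lintegral_pathMeasure r ρ c (hvz.indicator hE')]
  have h1 : ∀ x, ∑' z : (attracted r c ∩
      (fun z : PathSpace r => z.1 0) ⁻¹' {x} : Set (PathSpace r)), (shift r ⁻¹' E).indicator
        (fun z => ((r ⁻¹' {r (z.1 0)}).encard : ℝ≥0∞)) (z : PathSpace r) =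
      ((r ⁻¹' {r x}).encard : ℝ≥0∞) * e x := by
    intro x
    simp only [e]
    rw [inter_assoc, ← tsum_indicator_const_eq_mul_encard]
    refine tsum_congr fun z => ?_
    have hz : (z : PathSpace r).1 0 = x := z.2.2
    by_cases hzE : (z : PathSpace r) ∈ shift r ⁻¹' E
    · rw [indicator_of_mem hzE, indicator_of_mem hzE, hz]
    · rw [indicator_of_notMem hzE, indicator_of_notMem hzE]
  simp_rw [h1]
  -- On the fibre over `x` the factor `#r⁻¹(r y)` is the constant `#r⁻¹(x)` and cancels the
  -- normalization.
  rw [hρ.lintegral_eq hr_fin (hv.fun_mul he), pathMeasure_apply r ρ c hE]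
  refine lintegral_congr fun x => ?_
  have h2 : ∀ y : (r ⁻¹' {x} : Set X), ((r ⁻¹' {r (y : X)}).encard : ℝ≥0∞) * e y =
      ((r ⁻¹' {x}).encard : ℝ≥0∞) * e y := by
    intro y
    have : r (y : X) = x := y.2
    rw [this]
  have h3 : ((r ⁻¹' {x}).encard : ℝ≥0∞) ≠ 0 := by
    obtain ⟨y, hy⟩ := hr_surj x
    have : (r ⁻¹' {x}).encard ≠ 0 := Set.encard_ne_zero.2 ⟨y, hy⟩
    exact_mod_cast this
  simp_rw [h2]
  rw [ENNReal.tsum_mul_left, ← mul_assoc,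
    ENNReal.inv_mul_cancel h3 (encard_fiber_ne_top hr_fin x), tsum_encard_shift hc]

/-- The weight of the unitary operator. -/
noncomputable def weight (r : C(X, X)) [NeZero p] (c : Fin p → X) (α : Fin p → ℂ)
    (z : PathSpace r) : ℂ :=
  α (limitIndex r c z) * (Real.sqrt ((r ⁻¹' {r (z.1 0)}).ncard : ℝ) : ℂ)

omit [CompactSpace X] [MeasurableSpace X] [BorelSpace X] hr_surj hρ in
theorem enorm_weight_sq [NeZero p] {α : Fin p → ℂ} (hα : ∀ i, ‖α i‖ = 1) (z : PathSpace r) :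
    ‖weight r c α z‖ₑ ^ 2 = ((r ⁻¹' {r (z.1 0)}).encard : ℝ≥0∞) := by
  rw [encard_fiber_eq_ncard hr_fin, ← ofReal_norm, ← ENNReal.ofReal_pow (norm_nonneg _), weight,
    norm_mul, hα, one_mul, Complex.norm_real, Real.norm_eq_abs, sq_abs,
    Real.sq_sqrt (Nat.cast_nonneg _), ENNReal.ofReal_natCast]

omit [CompactSpace X] [MeasurableSpace X] [BorelSpace X] hr_surj hρ in
theorem weight_ne_zero [NeZero p] {α : Fin p → ℂ} (hα : ∀ i, ‖α i‖ = 1) (z : PathSpace r) :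
    weight r c α z ≠ 0 := by
  refine mul_ne_zero (norm_ne_zero_iff.1 (by rw [hα]; exact one_ne_zero)) ?_
  rw [Complex.ofReal_ne_zero, Real.sqrt_ne_zero (Nat.cast_nonneg _), Nat.cast_ne_zero]
  exact Set.ncard_ne_zero_of_mem (a := z.1 0) rfl (hr_fin _)

theorem aestronglyMeasurable_weight [NeZero p] (hc : IsCycle r c) (α : Fin p → ℂ) :
    AEStronglyMeasurable (weight r c α) (pathMeasure r ρ c) := by
  have hvz : AEMeasurable (fun z : PathSpace r => ((r ⁻¹' {r (z.1 0)}).encard : ℝ≥0∞))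
      (pathMeasure r ρ c) := (aemeasurable_card_fiber_comp hr_surj hr_fin
        hρ).comp_quasiMeasurePreserving (quasiMeasurePreserving_start r ρ c)
  have h1 : AEMeasurable (fun z : PathSpace r => ((r ⁻¹' {r (z.1 0)}).ncard : ℝ))
      (pathMeasure r ρ c) := by
    refine hvz.ennreal_toReal.congr (Eventually.of_forall fun z => ?_)
    dsimp only
    rw [encard_fiber_eq_ncard hr_fin, ENNReal.toReal_natCast]
  refine AEMeasurable.aestronglyMeasurable (AEMeasurable.mul ?_ ?_)
  · exact ((measurable_from_top (f := α)).comp (measurable_limitIndex r hc)).aemeasurable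
  · exact Complex.measurable_ofReal.comp_aemeasurable (h1.sqrt)

end Density

/-- Every non-empty open set of starting points carries a set of paths of finite positive
measure. -/
theorem exists_measurableSet_pathMeasure_pos [ρ.IsOpenPosMeasure]
    (hN : ∀ x, (cyclePaths r c x).Nonempty) {W : Set X} (hW : IsOpen W) (hWne : W.Nonempty) :
    ∃ E : Set (PathSpace r), MeasurableSet E ∧ (∀ z ∈ E, z.1 0 ∈ W) ∧
      pathMeasure r ρ c E ≠ 0 ∧ pathMeasure r ρ c E ≠ ⊤ := by
  let q : PathSpace r → X := fun z => z.1 0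
  have hB : MeasurableSet (attracted r c ∩ q ⁻¹' W) :=
    (measurableSet_attracted r c).inter (hW.preimage (continuous_start r)).measurableSet
  -- Attracted paths start everywhere in `W`, so the image has positive measure.
  have himg : q '' (attracted r c ∩ q ⁻¹' W) = W := by
    refine (image_subset_iff.2 inter_subset_right).antisymm fun x hx => ?_
    obtain ⟨z, hz, hz'⟩ := hN x
    have h0 : z.1 0 = x := hz
    exact ⟨z, ⟨hz', by rwa [mem_preimage, show q z = x from h0]⟩, h0⟩
  obtain ⟨E, hEB, hE, hEinj, hEpos⟩ := exists_measurableSet_injOn_measure_image_pos ρ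
    (continuous_start r) hB (by rw [himg]; exact hW.measure_pos ρ hWne)
  refine ⟨E, hE, fun z hz => (hEB hz).2, fun h0 => ?_, ?_⟩
  · have h1 := ae_start_of_ae r ρ c (measure_eq_zero_iff_ae_notMem.1 h0)
    refine hEpos.ne' (measure_eq_zero_iff_ae_notMem.2 ?_)
    filter_upwards [h1] with x hx
    rintro ⟨z, hz, hzx⟩
    exact hx z ⟨(hEB hz).1, hzx⟩ hz
  -- `E` meets each fibre at most once, so its measure is at most that of `X`.
  · rw [pathMeasure_apply r ρ c hE]
    refine ne_top_of_le_ne_top (b := ∫⁻ _, 1 ∂ρ) (by simp) (lintegral_mono fun x => ?_)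
    have : ((E ∩ attracted r c) ∩ (fun z : PathSpace r => z.1 0) ⁻¹' {x}).encard ≤ 1 := by
      rw [Set.encard_le_one_iff]
      rintro a b ⟨⟨ha, -⟩, ha'⟩ ⟨⟨hb, -⟩, hb'⟩
      exact hEinj ha hb (ha'.trans hb'.symm)
    rw [one_mul]
    exact (ENat.toENNReal_mono this).trans_eq ENat.toENNReal_one

/-- The operator is tested on the indicator of a set of finite positive measure on which `f` has no
zeros. -/
theorem mulOp_ne_zero [ρ.IsOpenPosMeasure] (hN : ∀ x, (cyclePaths r c x).Nonempty)
    {W : Set X} (hW : IsOpen W) (hWne : W.Nonempty) {f : C(PathSpace r, ℂ)}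
    (hf : ∀ z : PathSpace r, z.1 0 ∈ W → f z ≠ 0) : mulOp (pathMeasure r ρ c) f ≠ 0 := by
  intro h
  obtain ⟨E, hE, hEW, hE0, hEtop⟩ := exists_measurableSet_pathMeasure_pos (ρ := ρ) hN hW hWne
  refine hE0 (measure_eq_zero_iff_ae_notMem.2 ?_)
  have h1 := coeFn_mulOp (pathMeasure r ρ c) f (indicatorConstLp 2 hE hEtop (1 : ℂ))
  rw [h] at h1
  filter_upwards [h1, Lp.coeFn_zero ℂ 2 (pathMeasure r ρ c),
    indicatorConstLp_coeFn (p := 2) (hs := hE) (hμs := hEtop) (c := (1 : ℂ))] with z h2 h3 h4 hz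
  rw [zero_apply, h3, h4, indicator_of_mem hz, mul_one] at h2
  exact hf z (hEW z hz) h2.symm

end PathMeasure

end Solenoid

/-! ### The unitary operator and the faithful representation -/

theorem mainTheorem4 {X : Type u} [MetricSpace X] [CompactSpace X] [MeasurableSpace X]
    [BorelSpace X]
    -- a continuous, finite-to-one, non-invertible map of `X` onto itself
    (r : C(X, X)) (hr_surj : Function.Surjective r) (hr_fin : ∀ x, (r ⁻¹' {x}).Finite)
    (hr_ninj : ¬ Function.Injective r)
    -- a strongly invariant probability measure that charges every non-empty open set
    (ρ : Measure X) [IsProbabilityMeasure ρ] [ρ.IsOpenPosMeasure]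
    (hρ : Solenoid.IsStronglyInvariant r ρ)
    -- a cycle, and numbers of modulus one
    {p : ℕ} [NeZero p] (c : Fin p → X) (hc : Solenoid.IsCycle r c)
    (α : Fin p → ℂ) (hα : ∀ i, ‖α i‖ = 1)
    -- from every point starts a path that is attracted by the cycle
    (hN : ∀ x, (Solenoid.cyclePaths r c x).Nonempty) :
    ∃ U : unitary (Solenoid.L2Operators (Solenoid.pathMeasure r ρ c)),
      -- `U ξ (ω) = α_{i(ω)} √(#r⁻¹(r(x))) ξ (r̂ ω)`, whatever representative of `ξ` is taken
      (∀ (ξ : Lp ℂ 2 (Solenoid.pathMeasure r ρ c)) (g : Solenoid.PathSpace r → ℂ),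
        ξ =ᵐ[Solenoid.pathMeasure r ρ c] g →
        (U : Solenoid.L2Operators (Solenoid.pathMeasure r ρ c)) ξ
          =ᵐ[Solenoid.pathMeasure r ρ c] fun ω =>
            α (Solenoid.limitIndex r c ω) *
              (Real.sqrt ((r ⁻¹' {r (ω.1 0)}).ncard : ℝ) : ℂ) * g (Solenoid.shift r ω)) ∧
      -- the covariance relation `U M_f U* = M_{f ∘ r̂}`
      (∀ f : C(Solenoid.PathSpace r, ℂ),
        (U : Solenoid.L2Operators (Solenoid.pathMeasure r ρ c)) *
            Solenoid.mulOp (Solenoid.pathMeasure r ρ c) f *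
            star (U : Solenoid.L2Operators (Solenoid.pathMeasure r ρ c)) =
          Solenoid.mulOp (Solenoid.pathMeasure r ρ c)
            (f.comp (Solenoid.shift r : C(Solenoid.PathSpace r, Solenoid.PathSpace r)))) ∧
      -- the representation `(f, k) ↦ M_f U^k` of the crossed product exists and is faithful
      ∃ Φ : Solenoid.crossedProduct (Solenoid.shift r) →⋆ₐ[ℂ]
          Solenoid.L2Operators (Solenoid.pathMeasure r ρ c),
        (∀ (f : C(Solenoid.PathSpace r, ℂ)) (k : ℤ),
          Φ (Solenoid.symbol (Solenoid.shift r) f k) =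
            Solenoid.mulOp (Solenoid.pathMeasure r ρ c) f *
              (U ^ k : unitary (Solenoid.L2Operators (Solenoid.pathMeasure r ρ c)))) ∧
        Function.Injective Φ := by
  obtain ⟨U, hU⟩ := Solenoid.exists_unitary_weightedComp (σ := (Solenoid.shift r).toMeasurableEquiv)
    (Solenoid.aestronglyMeasurable_weight hr_surj hr_fin hρ hc α)
    (Solenoid.weight_ne_zero hr_fin hα) (fun E hE => by
      simp_rw [Solenoid.enorm_weight_sq hr_fin hα]
      exact Solenoid.lintegral_shift_preimage hr_surj hr_fin hρ hc hE)
  have hcov : ∀ f : C(Solenoid.PathSpace r, ℂ),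
      (U : Solenoid.L2Operators (Solenoid.pathMeasure r ρ c)) *
          Solenoid.mulOp (Solenoid.pathMeasure r ρ c) f *
          star (U : Solenoid.L2Operators (Solenoid.pathMeasure r ρ c)) =
        Solenoid.mulOp (Solenoid.pathMeasure r ρ c)
          (f.comp (Solenoid.shift r : C(Solenoid.PathSpace r, Solenoid.PathSpace r))) := by
    intro f
    have h1 : (U : Solenoid.L2Operators (Solenoid.pathMeasure r ρ c)) *
          Solenoid.mulOp (Solenoid.pathMeasure r ρ c) f =
        Solenoid.mulOp (Solenoid.pathMeasure r ρ c)
          (f.comp (Solenoid.shift r : C(Solenoid.PathSpace r, Solenoid.PathSpace r))) * U := by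
      refine ContinuousLinearMap.ext fun ξ => Lp.ext ?_
      rw [mul_apply_eq_comp, mul_apply_eq_comp]
      -- The formula for `U` is used with the representative `f · ξ` of `M_f ξ`, which is why it is
      -- stated for arbitrary representatives.
      filter_upwards [hU _ _ (Solenoid.coeFn_mulOp (Solenoid.pathMeasure r ρ c) f ξ),
        hU ξ ξ EventuallyEq.rfl, Solenoid.coeFn_mulOp (Solenoid.pathMeasure r ρ c)
          (f.comp (Solenoid.shift r : C(Solenoid.PathSpace r, Solenoid.PathSpace r)))
          ((U : Solenoid.L2Operators (Solenoid.pathMeasure r ρ c)) ξ)] with z h2 h3 h4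
      rw [h2, h4, h3]
      exact mul_left_comm _ _ _
    rw [h1, mul_assoc, ← Unitary.coe_star, Unitary.coe_mul_star_self, mul_one]
  have : Nonempty X := nonempty_of_isProbabilityMeasure ρ
  have hnt : Nontrivial (Lp ℂ 2 (Solenoid.pathMeasure r ρ c)) := by
    by_contra hsub
    rw [not_nontrivial_iff_subsingleton] at hsub
    exact Solenoid.mulOp_ne_zero (ρ := ρ) hN isOpen_univ univ_nonempty
      (f := (1 : C(Solenoid.PathSpace r, ℂ))) (fun _ _ => one_ne_zero)
      (ContinuousLinearMap.ext fun ξ => Subsingleton.elim _ _)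
  let R : Solenoid.CovariantRep (Solenoid.shift r) :=
    { H := Lp ℂ 2 (Solenoid.pathMeasure r ρ c)
      π := Solenoid.mulRep (Solenoid.pathMeasure r ρ c)
      V := U
      covariance := hcov }
  have hπ : Function.Injective R.π := by
    rw [injective_iff_map_eq_zero]
    intro f hf
    by_contra hf0
    obtain ⟨y, hy⟩ := DFunLike.ne_iff.1 hf0
    obtain ⟨n, W, hW, hyW, hWV⟩ := Solenoid.exists_cylinder_subset r.continuous
      (isOpen_ne_fun f.continuous continuous_const) hy
    -- By covariance the kernel is invariant under `r̂`, so `f ∘ r̂ⁿ` lies in it too, and this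
    -- function has no zeros where `z_0 ∈ W`.
    refine Solenoid.mulOp_ne_zero (ρ := ρ) hN hW ⟨_, hyW⟩
      (f := Solenoid.CovariantRep.comp (Solenoid.shift r) n f) (fun z hz => ?_) ?_
    · refine hWV _ ?_
      change ((Solenoid.shift r ^ n : Solenoid.PathSpace r ≃ₜ Solenoid.PathSpace r) z).1 n ∈ W
      rwa [Solenoid.shift_zpow_apply, sub_self]
    · have h1 := R.pow_mul n f
      rw [hf, mul_zero] at h1
      have h2 : R.π (Solenoid.CovariantRep.comp (Solenoid.shift r) n f) =
          R.π (Solenoid.CovariantRep.comp (Solenoid.shift r) n f) * R.pow n * R.pow (-n) := by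
        rw [mul_assoc, ← R.pow_add, add_neg_cancel, R.pow_zero, mul_one]
      rw [← h1, zero_mul] at h2
      exact h2
  refine ⟨U, fun ξ g hg => hU ξ g hg, hcov,
    (Solenoid.evalRep R).comp (Solenoid.crossedProduct (Solenoid.shift r)).subtype,
    fun f k => rfl, ?_⟩
  exact Solenoid.injective_evalRep R hπ
    (Solenoid.dense_aperiodic r.continuous hc hN hr_ninj)
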